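/- **Setting.** Let $T$ be a real function, $\mathfrak c\in[0,1]$, $\Delta=T(\mathfrak c)$, $\Gamma=1-\Delta$, $\tilde I=[-\Gamma,1]$, and $d_1<d_2$ with $[d_1,d_2]\subset[0,1]$. Assume: * (A) $T$ is continuous on $\tilde I$, maps $[0,1]$ into $[0,1]$, $T(x)<\Delta<1$ for all $x\in[0,1]\setminus\{\mathfrak c\}$, and $T$ is decreasing (not necessarily strictly) on $[-\Gamma,0]$ with $T(-\Gamma)<\Delta$. The interval $[d_1,d_2]$ is forward invariant, and $T^k|_{[d_1,d_2]}$ is topologically transitive for every $k\ge1$. For Lebesgue-a.e. $x\in[0,1]$ the orbit of $x$ under $T$ enters every neighbourhood of $[d_1,d_2]$. There is exactly one $T$-invariant Borel probability measure on $[0,1]$ that is absolutely continuous with respect to Lebesgue measure. * (B) For $n\ge1$, $\sigma_n:\tilde I\to[0,\infty)$ is continuous, differentiable on $(0,1)$ and positive on $\tilde I\setminus\{0,1\}$, and $\sigma_n(x)\to0$ as $n\to\infty$ for every $x\in\tilde I$. Fix $n\ge1$ and $a>0$, put $\sigma_{\max}=\max_{\tilde I}\sigma_n$, and assume one of the following.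 * (B1) $T(0)=0$, $\sigma_n(0)=0$, $a\le\frac1{\sigma_{\max}}\frac{\Gamma}{2}$, and there is $\varepsilon\in(0,1-\frac\Gamma2)$ such that $T-a\sigma_n>0$ on $(0,1-\frac\Gamma2]$, $T(x)-a\sigma_n(x)>x$ for $x\in(0,\varepsilon)$, and $T-a\sigma_n>\varepsilon$ on $(\varepsilon,1-\frac\Gamma2)$. * (B2) $T(0)=q>0$, $a\le\frac1{\sigma_{\max}}\min\{\frac\Gamma2,\frac q2,\frac12T(1-\frac\Gamma2)\}$, and $T-a\sigma_n>0$ on $(0,1-\frac\Gamma2]$ (the last condition is automatic if $T$ is monotone on each side of $\mathfrak c$). * (C) The noise variables $Y_t$ are i.i.d. with density $g_a(y)=c_a\chi(y)e^{-y^2/2}$, where $\chi\ge0$ is $C^\infty$ with support $[-a,a]$ and $c_a=(\int\chi(y)e^{-y^2/2}dy)^{-1}$. Consider the Markov chain $X_{t+1}=T(X_t)+\sigma_n(X_t)Y_{t+1}$ on $\tilde I$, with transition probabilities $P_x=\mathrm{Law}(T(x)+\sigma_n(x)Y_1)$, and the Markov operator on densities $$(\mathcal Lf)(y)=\int_{\tilde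 I}p_n(x,y)f(x)\,dx,\qquad p_n(x,y)=\frac1{\sigma_n(x)}\,g_a\!\left(\frac{y-T(x)}{\sigma_n(x)}\right).$$ **Statement.** The chain has a stationary probability measure $\mu_n$ on $\tilde I$ which is absolutely continuous with a density $h_n\ge0$ of bounded variation on $\tilde I$, and $[d_1,d_2]\subset\operatorname{supp}\mu_n$. It is the only stationary probability measure on $\tilde I$ if $T(0)>0$, and the only one that gives no mass to the fixed point $0$ if $T(0)=0$; in particular it is the only absolutely continuous one in both cases. Moreover, let $J=[\varepsilon,1-\frac\Gamma2]$ in case (B1), for any $\varepsilon$ as there, and $J=\tilde I$ in case (B2). There are $0<r<1$ and $C>0$ such that for all $f\in L^1(J)$ (extended by $0$), all $g$ of bounded variation on $J$ and all integers $t\ge0$, the function $(\mathcal L^tf)g$ is integrable on $J$ and $$\Big|\int_J(\mathcal L^tf)(x)\,g(x)\,dx-\int_J f\,dx\int_J g\,d\mu_n\Big|\le C\,r^t\,\|f\|_1\,\|g\|_{BV},\qquad \|g\|_{BV}=|g|_{TV,J}+\|g\|_{L^1(J)}.$$ -/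

import Mathlib

open MeasureTheory Set Filter Topology

namespace HeteroChain

noncomputable section

/-- The gap between the maximal value `T c` of the map and `1`. -/
def gap (T : ℝ → ℝ) (c : ℝ) : ℝ := 1 - T c

/-- The enlarged state space `[-Γ, 1]`. -/
def stateSpace (T : ℝ → ℝ) (c : ℝ) : Set ℝ := Icc (-(gap T c)) 1

/-- Topological transitivity of the restriction of `S` to the (forward invariant) subspace `X`. -/
def TransitiveOn (S : ℝ → ℝ) (X : Set ℝ) : Prop :=
  ∀ U V : Set ℝ, IsOpen U → IsOpen V → (U ∩ X).Nonempty → (V ∩ X).Nonempty →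
    ∃ t : ℕ, (S^[t] ⁻¹' U ∩ (V ∩ X)).Nonempty

/-- The assumptions on the deterministic map, a self-map of `[0, 1]` extended to `[-Γ, 1]`. -/
structure IsAdmissibleMap (T : ℝ → ℝ) (c d₁ d₂ : ℝ) : Prop where
  mapsTo : MapsTo T (Icc 0 1) (Icc 0 1)
  max_mem : c ∈ Icc (0 : ℝ) 1
  max_unique : ∀ x ∈ Icc (0 : ℝ) 1, x ≠ c → T x < T c
  max_lt_one : T c < 1
  -- the extension to `[-Γ, 0]` is continuous and decreasing, and stays below the maximum
  continuousOn : ContinuousOn T (stateSpace T c)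
  antitoneOn : AntitoneOn T (Icc (-(gap T c)) 0)
  left_lt : T (-(gap T c)) < T c
  -- the transitive interval
  lt : d₁ < d₂
  subset : Icc d₁ d₂ ⊆ Icc (0 : ℝ) 1
  forward_invariant : MapsTo T (Icc d₁ d₂) (Icc d₁ d₂)
  transitive : ∀ k : ℕ, 1 ≤ k → TransitiveOn (T^[k]) (Icc d₁ d₂)
  -- there is no other attracting component: typical orbits come arbitrarily close to `[d₁, d₂]`
  absorbing : ∀ᵐ x ∂(volume.restrict (Icc (0 : ℝ) 1)),
    ∀ U : Set ℝ, IsOpen U → Icc d₁ d₂ ⊆ U → ∃ k : ℕ, T^[k] x ∈ U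
  -- the unique absolutely continuous invariant probability measure
  unique_acip : ∃! η : Measure ℝ, IsProbabilityMeasure η ∧ η (Icc (0 : ℝ) 1)ᶜ = 0 ∧
    η.map T = η ∧ η ≪ volume

/-- The maximal value of the noise amplitude on the state space. -/
def sigmaMax (T : ℝ → ℝ) (c : ℝ) (s : ℝ → ℝ) : ℝ := sSup (s '' stateSpace T c)

/-- The assumptions on the noise amplitudes `σ n`. -/
structure IsNoiseAmplitude (T : ℝ → ℝ) (c : ℝ) (σ : ℕ → ℝ → ℝ) : Prop where
  continuousOn : ∀ n, 1 ≤ n → ContinuousOn (σ n) (stateSpace T c)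
  differentiableOn : ∀ n, 1 ≤ n → DifferentiableOn ℝ (σ n) (Ioo 0 1)
  nonneg : ∀ n, 1 ≤ n → ∀ x ∈ stateSpace T c, 0 ≤ σ n x
  -- only the points `0` and `1` may be free of noise
  pos : ∀ n, 1 ≤ n → ∀ x ∈ stateSpace T c, x ≠ 0 → x ≠ 1 → 0 < σ n x
  tendsto_zero : ∀ x ∈ stateSpace T c, Tendsto (fun n => σ n x) atTop (𝓝 0)

/-- Compatibility of map, amplitude and noise range `a` when `0` is a fixed point of `T`. -/
structure FixedOriginCase (T : ℝ → ℝ) (c : ℝ) (s : ℝ → ℝ) (a ε : ℝ) : Prop where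
  map_zero : T 0 = 0
  sigma_zero : s 0 = 0
  bound : a ≤ 1 / sigmaMax T c s * (gap T c / 2)
  eps_pos : 0 < ε
  eps_lt : ε < 1 - gap T c / 2
  lower_pos : ∀ x ∈ Ioc 0 (1 - gap T c / 2), 0 < T x - a * s x
  lower_gt_self : ∀ x ∈ Ioo 0 ε, x < T x - a * s x
  lower_gt_eps : ∀ x ∈ Ioo ε (1 - gap T c / 2), ε < T x - a * s x

/-- Compatibility of map, amplitude and noise range `a` when `T 0 > 0`. The last condition is
automatic if `T` is monotone on both sides of its maximum. -/
structure PositiveInterceptCase (T : ℝ → ℝ) (c : ℝ) (s : ℝ → ℝ) (a : ℝ) : Prop where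
  map_zero_pos : 0 < T 0
  bound : a ≤ 1 / sigmaMax T c s *
    min (gap T c / 2) (min (T 0 / 2) (T (1 - gap T c / 2) / 2))
  lower_pos : ∀ x ∈ Ioc 0 (1 - gap T c / 2), 0 < T x - a * s x

/-- `χ` is a smooth bump function on `[-a, a]`. -/
structure IsBump (χ : ℝ → ℝ) (a : ℝ) : Prop where
  smooth : ContDiff ℝ ((⊤ : ℕ∞) : WithTop ℕ∞) χ
  nonneg : ∀ y, 0 ≤ χ y
  tsupport_eq : tsupport χ = Icc (-a) a

/-- The noise density `g_a(y) = c_a χ(y) exp(-y²/2)`. -/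
def noiseDensity (χ : ℝ → ℝ) (y : ℝ) : ℝ :=
  (∫ u, χ u * Real.exp (-u ^ 2 / 2))⁻¹ * (χ y * Real.exp (-y ^ 2 / 2))

/-- The law of each of the i.i.d. noise variables. -/
def noiseLaw (χ : ℝ → ℝ) : Measure ℝ :=
  volume.withDensity fun y => ENNReal.ofReal (noiseDensity χ y)

/-- The transition probability from `x`: the law of `T x + σ x * Y`. -/
def transition (T s χ : ℝ → ℝ) (x : ℝ) : Measure ℝ :=
  (noiseLaw χ).map fun y => T x + s x * y

/-- The map, the amplitude with index `n` and the noise form a random system. -/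
structure IsRandomSystem (T : ℝ → ℝ) (c d₁ d₂ : ℝ) (σ : ℕ → ℝ → ℝ) (χ : ℝ → ℝ) (a : ℝ)
    (n : ℕ) : Prop where
  map : IsAdmissibleMap T c d₁ d₂
  amplitude : IsNoiseAmplitude T c σ
  index_pos : 1 ≤ n
  a_pos : 0 < a
  bump : IsBump χ a
  cases : (∃ ε, FixedOriginCase T c (σ n) a ε) ∨ PositiveInterceptCase T c (σ n) a

/-- `ν` is a stationary probability measure of the Markov chain on `[-Γ, 1]`. -/
structure IsStationary (T : ℝ → ℝ) (c : ℝ) (s χ : ℝ → ℝ) (ν : Measure ℝ) : Prop where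
  prob : IsProbabilityMeasure ν
  concentrated : ν (stateSpace T c)ᶜ = 0
  stationary : ∀ A : Set ℝ, MeasurableSet A → ∫⁻ x, transition T s χ x A ∂ν = ν A

/-- The stochastic kernel `p(x, y)`, the density of the transition probability where `s x > 0`. -/
def kernelDensity (T s χ : ℝ → ℝ) (x y : ℝ) : ℝ :=
  (s x)⁻¹ * noiseDensity χ ((y - T x) / s x)

/-- The Markov operator on densities. -/
def markovOp (T : ℝ → ℝ) (c : ℝ) (s χ : ℝ → ℝ) (f : ℝ → ℝ) (y : ℝ) : ℝ :=
  ∫ x in stateSpace T c, kernelDensity T s χ x y * f x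

/-- The norm `|g|_TV + ‖g‖₁` of a function of bounded variation on `J`. -/
def bvNorm (g : ℝ → ℝ) (J : Set ℝ) : ℝ :=
  (eVariationOn g J).toReal + ∫ x in J, |g x|

/-- Exponential decay of correlations on `J`, for `f ∈ L¹(J)` (extended by zero) and
`g ∈ BV(J)`. -/
def ExponentialDecayOn (T : ℝ → ℝ) (c : ℝ) (s χ : ℝ → ℝ) (μ : Measure ℝ) (J : Set ℝ) : Prop :=
  ∃ r C : ℝ, 0 < r ∧ r < 1 ∧ 0 < C ∧
    ∀ f g : ℝ → ℝ, Integrable f → Function.support f ⊆ J → BoundedVariationOn g J →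
      ∀ t : ℕ,
        IntegrableOn (fun x => ((markovOp T c s χ)^[t] f) x * g x) J ∧
        |(∫ x in J, ((markovOp T c s χ)^[t] f) x * g x) - (∫ x, f x) * ∫ x in J, g x ∂μ| ≤
          C * r ^ t * (∫ x, |f x|) * bvNorm g J

end

end HeteroChain

/-!
The noisy orbits that matter end up in a trapping interval `[α, 1 - Γ/2]` with `α > 0`, where the
noise does not degenerate. In case (B1) one takes `α = ε`: the mean of the Lyapunov function
`min x ε` strictly increases in one step as long as `0 < x < ε`, so that a stationary measure
without mass at `0` lives on the trap. In case (B2) the second step of the chain already falls into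
the trap.

From every point of the trap, every neighbourhood of every point of `[d₁, d₂]` is reached with
positive probability: a noisy step leads to a point with an orbit attracted by `[d₁, d₂]`, where
transitivity takes over. For a Feller chain the set of starting points that reach an open set is
open, and by compactness one number of steps works for the whole trap; near a fixed point in
`[d₁, d₂]` the transition densities have a common lower bound. Hence the trap is a small set. The
mass shared by all laws gives Doeblin's contraction of oscillations and thus uniform ergodicity, and
the regeneration scheme with the shared mass gives a stationary measure. It has a Lipschitz
density, as an average of Lipschitz transition densities. Decay of correlations is ergodicity in
dual form: `∫ (𝓛ᵗ f) g` is the integral of `f` against the mean of `g` after `t` steps, and the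
supremum of `|g|` is at most a multiple of its `BV` norm.
-/

namespace HeteroChain

open ProbabilityTheory
open scoped ENNReal

section MarkovKernel

variable {X : Type*} [MeasurableSpace X] {P Q : Kernel X X} {K : Set X} {μ ν : Measure X}

instance isMarkovKernel_mul [IsMarkovKernel P] [IsMarkovKernel Q] : IsMarkovKernel (P * Q) :=
  inferInstanceAs (IsMarkovKernel (P ∘ₖ Q))

instance isMarkovKernel_pow [IsMarkovKernel P] (n : ℕ) : IsMarkovKernel (P ^ n) := by
  induction n with
  | zero => exact inferInstanceAs (IsMarkovKernel Kernel.id)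
  | succ n ih => exact inferInstanceAs (IsMarkovKernel ((P ^ n) ∘ₖ P))

/-- The set `K` is absorbing for `P`: the chain stays in `K` once it is there. -/
def IsAbsorbing (P : Kernel X X) (K : Set X) : Prop :=
  ∀ x ∈ K, ∀ᵐ y ∂P x, y ∈ K

theorem IsAbsorbing.mul (hP : IsAbsorbing P K) (hQ : IsAbsorbing Q K) (hK : MeasurableSet K) :
    IsAbsorbing (P * Q) K := fun x hx =>
  (Kernel.ae_comp_iff hK).2 ((hQ x hx).mono hP)

theorem IsAbsorbing.pow (hP : IsAbsorbing P K) (hK : MeasurableSet K) (n : ℕ) :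
    IsAbsorbing (P ^ n) K := by
  induction n with
  | zero => exact fun x hx => (ae_dirac_iff hK).2 hx
  | succ n ih => exact ih.mul hP hK

theorem integral_mul_apply {φ : X → ℝ} {x : X} (hφ : Integrable φ ((P * Q) x)) :
    ∫ y, φ y ∂(P * Q) x = ∫ y, ∫ z, φ z ∂P y ∂Q x :=
  Kernel.integral_comp hφ

theorem invariant_pow (hμ : P.Invariant μ) (n : ℕ) : (P ^ n).Invariant μ := by
  induction n with
  | zero => exact Measure.id_comp
  | succ n ih => exact ih.comp hμ

theorem comp_const_of_invariant (hμ : P.Invariant μ) : (P ∘ₖ Kernel.const Unit μ) () = μ := by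
  rw [Kernel.comp_const, hμ.def]
  rfl

theorem integral_integral_of_invariant (hμ : P.Invariant μ) {φ : X → ℝ} (hφ : Integrable φ μ) :
    ∫ x, ∫ y, φ y ∂P x ∂μ = ∫ x, φ x ∂μ := by
  rw [← comp_const_of_invariant hμ] at hφ
  simpa only [comp_const_of_invariant hμ, Kernel.const_apply] using (Kernel.integral_comp hφ).symm

/-! ### Contraction of oscillations -/

/-- The oscillation of `φ` on `K` is at most `D`. The supremum and the infimum of `φ` over `K`
are replaced by the end points of an interval that contains `φ '' K`. -/
def HasOscillationLE (φ : X → ℝ) (K : Set X) (D : ℝ) : Prop :=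
  ∃ m, ∀ x ∈ K, φ x ∈ Icc m (m + D)

theorem HasOscillationLE.integrable [IsFiniteMeasure μ] {φ : X → ℝ} {D : ℝ}
    (hφ : HasOscillationLE φ K D) (hφm : Measurable φ) (hμ : ∀ᵐ x ∂μ, x ∈ K) :
    Integrable φ μ :=
  let ⟨m, hm⟩ := hφ
  .of_mem_Icc m (m + D) hφm.aemeasurable (hμ.mono hm)

/-- The mass shared by all the laws `P x` does not contribute to differences of their means. -/
theorem HasOscillationLE.integral [IsMarkovKernel P] {φ : X → ℝ} {D : ℝ}
    (hφ : HasOscillationLE φ K D) (hφm : Measurable φ) (hP : IsAbsorbing P K)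
    (hν : ∀ x ∈ K, ν ≤ P x) :
    HasOscillationLE (fun x => ∫ y, φ y ∂P x) K ((1 - ν.real univ) * D) := by
  obtain ⟨m, hm⟩ := id hφ
  refine ⟨(∫ y, φ y ∂ν) + (1 - ν.real univ) * m, fun x hx => ?_⟩
  have hmem : ∀ᵐ y ∂P x, φ y ∈ Icc m (m + D) := (hP x hx).mono hm
  have hint : Integrable φ (P x) := hφ.integrable hφm (hP x hx)
  have hfin : IsFiniteMeasure ν := isFiniteMeasure_of_le (P x) (hν x hx)
  have hintν : Integrable φ ν := hint.mono_measure (hν x hx)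
  have hlower := integral_mono_measure (hν x hx)
    (hmem.mono fun y hy => sub_nonneg.2 hy.1) (hint.sub (integrable_const m))
  have hupper := integral_mono_measure (hν x hx)
    (hmem.mono fun y hy => sub_nonneg.2 hy.2) ((integrable_const (m + D)).sub hint)
  simp only [integral_sub, integrable_const, hint, hintν, integral_const, probReal_univ,
    smul_eq_mul, one_mul] at hlower hupper
  constructor <;> dsimp only <;> linarith

theorem HasOscillationLE.integral_mul [IsMarkovKernel P] [IsMarkovKernel Q] {φ : X → ℝ}
    {D D' : ℝ} (hφ : HasOscillationLE φ K D) (hφm : Measurable φ) (hK : MeasurableSet K)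
    (hP : IsAbsorbing P K) (hQ : IsAbsorbing Q K) (hν : ∀ x ∈ K, ν ≤ P x)
    (hQφ : HasOscillationLE (fun x => ∫ y, φ y ∂Q x) K D') :
    HasOscillationLE (fun x => ∫ y, φ y ∂(Q * P) x) K ((1 - ν.real univ) * D') := by
  obtain ⟨m, hm⟩ := hQφ.integral hφm.stronglyMeasurable.integral_kernel.measurable hP hν
  refine ⟨m, fun x hx => ?_⟩
  dsimp only
  rw [integral_mul_apply (hφ.integrable hφm (hQ.mul hP hK x hx))]
  exact hm x hx

theorem HasOscillationLE.integral_pow [IsMarkovKernel P] {φ : X → ℝ} {D : ℝ}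
    (hφ : HasOscillationLE φ K D) (hφm : Measurable φ) (hK : MeasurableSet K)
    (hP : IsAbsorbing P K) (hν : ∀ x ∈ K, ν ≤ P x) (k : ℕ) :
    HasOscillationLE (fun x => ∫ y, φ y ∂(P ^ k) x) K ((1 - ν.real univ) ^ k * D) := by
  induction k with
  | zero =>
    have hone (x : X) : ∫ y, φ y ∂(P ^ 0) x = φ x :=
      integral_dirac' φ x hφm.stronglyMeasurable
    simpa only [hone, pow_zero (1 - ν.real univ), one_mul] using hφ
  | succ k ih =>
    rw [pow_succ P, pow_succ', mul_assoc]
    exact hφ.integral_mul hφm hK hP (hP.pow hK k) hν ih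

theorem HasOscillationLE.abs_integral_sub_le [IsProbabilityMeasure μ] {φ : X → ℝ} {D : ℝ}
    (hφ : HasOscillationLE φ K D) (hφm : Measurable φ) (hμ : ∀ᵐ x ∂μ, x ∈ K) {x : X}
    (hx : x ∈ K) : |φ x - ∫ y, φ y ∂μ| ≤ D := by
  obtain ⟨m, hm⟩ := id hφ
  have hmean := (convex_Icc m (m + D)).integral_mem isClosed_Icc (hμ.mono hm)
    (hφ.integrable hφm hμ)
  exact (abs_sub_le_of_le_of_le (hm x hx).1 (hm x hx).2 hmean.1 hmean.2).trans_eq (by ring)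

/-! ### Small sets and uniform ergodicity -/

/-- The set `K` is small for `P`, in the sense of Meyn and Tweedie: for some `N`, the `N`-step
laws started in `K` have a common nonzero minorant. -/
def IsSmallSet (P : Kernel X X) (K : Set X) : Prop :=
  ∃ N ≠ 0, ∃ ν : Measure X, ν ≠ 0 ∧ ∀ x ∈ K, ν ≤ (P ^ N) x

/-- Started in `K`, the chain converges to `μ` geometrically fast and uniformly in the starting
point. Convergence is tested on measurable functions bounded on `K`. -/
def IsUniformlyErgodicOn (P : Kernel X X) (K : Set X) (μ : Measure X) : Prop :=
  ∃ r C : ℝ, 0 < r ∧ r < 1 ∧ 0 < C ∧ ∀ φ : X → ℝ, Measurable φ → ∀ M : ℝ,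
    (∀ x ∈ K, |φ x| ≤ M) → ∀ t : ℕ, ∀ x ∈ K,
      |∫ y, φ y ∂(P ^ t) x - ∫ y, φ y ∂μ| ≤ C * r ^ t * M

theorem IsSmallSet.of_enters [IsMarkovKernel P] {L : Set X} (hK : IsSmallSet P K) (k : ℕ)
    (hL : ∀ x ∈ L, ∀ᵐ y ∂(P ^ k) x, y ∈ K) : IsSmallSet P L := by
  obtain ⟨N, hN, ν, hν, hle⟩ := hK
  refine ⟨N + k, by lia, ν, hν, fun x hx => Measure.le_iff.2 fun A hA => ?_⟩
  calc ν A = ∫⁻ _, ν A ∂(P ^ k) x := by simp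
    _ ≤ ∫⁻ y, (P ^ N) y A ∂(P ^ k) x := lintegral_mono_ae ((hL x hx).mono fun y hy => hle y hy A)
    _ = (P ^ (N + k)) x A := by rw [add_comm, Kernel.pow_add_apply_eq_lintegral _ _ _ _ hA]

theorem exists_pow_div_le_mul_pow {q : ℝ} (hq : 0 ≤ q) (hq1 : q < 1) {N : ℕ} (hN : N ≠ 0) :
    ∃ r C : ℝ, 0 < r ∧ r < 1 ∧ 0 < C ∧ ∀ t : ℕ, q ^ (t / N) ≤ C * r ^ t := by
  obtain ⟨p, hqp, hp1⟩ := exists_between hq1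
  have hp : 0 < p := hq.trans_lt hqp
  set r : ℝ := p ^ (N : ℝ)⁻¹
  have hrN : r ^ N = p := Real.rpow_inv_natCast_pow hp.le hN
  have hr0 : 0 < r := Real.rpow_pos_of_pos hp _
  have hr1 : r < 1 := Real.rpow_lt_one hp.le hp1 (by positivity)
  refine ⟨r, p⁻¹, hr0, hr1, inv_pos.2 hp, fun t => ?_⟩
  have ht : t ≤ N * (t / N + 1) := (Nat.lt_mul_div_succ t (Nat.pos_of_ne_zero hN)).le
  calc q ^ (t / N) ≤ p ^ (t / N) := pow_le_pow_left₀ hq hqp.le _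
    _ = p⁻¹ * r ^ (N * (t / N + 1)) := by rw [pow_mul, hrN, pow_succ]; field_simp
    _ ≤ p⁻¹ * r ^ t :=
      mul_le_mul_of_nonneg_left (pow_le_pow_of_le_one hr0.le hr1.le ht) (inv_pos.2 hp).le

theorem IsSmallSet.isUniformlyErgodicOn [IsMarkovKernel P] [IsProbabilityMeasure μ]
    (hsmall : IsSmallSet P K) (hK : MeasurableSet K) (hP : IsAbsorbing P K)
    (hμ : P.Invariant μ) (hμK : ∀ᵐ x ∂μ, x ∈ K) : IsUniformlyErgodicOn P K μ := by
  obtain ⟨N, hN, ν, hν, hle⟩ := hsmall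
  obtain ⟨x₀, hx₀⟩ := hμK.exists
  have hfin : IsFiniteMeasure ν := isFiniteMeasure_of_le _ (hle x₀ hx₀)
  have hpos : 0 < ν.real univ :=
    ENNReal.toReal_pos (Measure.measure_univ_ne_zero.2 hν) (measure_ne_top ν univ)
  have hle1 : ν.real univ ≤ 1 :=
    ENNReal.toReal_le_of_le_ofReal one_pos.le (by simpa using hle x₀ hx₀ univ)
  obtain ⟨r, C, hr, hr1, hC, hrate⟩ :=
    exists_pow_div_le_mul_pow (sub_nonneg.2 hle1) (sub_lt_self 1 hpos) hN
  refine ⟨r, C * 2, hr, hr1, by positivity, fun φ hφm M hM t x hx => ?_⟩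
  have hφ : HasOscillationLE φ K (2 * M) :=
    ⟨-M, fun y hy => ⟨(abs_le.1 (hM y hy)).1, by linarith [(abs_le.1 (hM y hy)).2]⟩⟩
  have hblock := hφ.integral_pow hφm hK (hP.pow hK N) hle (t / N)
  have hosc := hφ.integral_mul hφm hK (hP.pow hK (t % N)) ((hP.pow hK N).pow hK (t / N))
    (fun y _ => Measure.zero_le ((P ^ (t % N)) y)) hblock
  rw [← pow_mul, ← pow_add, Nat.div_add_mod, measureReal_zero_apply, sub_zero, one_mul] at hosc
  have hM0 : 0 ≤ M := (abs_nonneg _).trans (hM x hx)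
  rw [← integral_integral_of_invariant (invariant_pow hμ t) (hφ.integrable hφm hμK)]
  calc _ ≤ (1 - ν.real univ) ^ (t / N) * (2 * M) :=
        hosc.abs_integral_sub_le hφm.stronglyMeasurable.integral_kernel.measurable hμK hx
    _ ≤ C * r ^ t * (2 * M) := by gcongr; exact hrate t
    _ = C * 2 * r ^ t * M := by ring

theorem IsUniformlyErgodicOn.eq_of_invariant [IsMarkovKernel P] [IsProbabilityMeasure μ]
    [IsProbabilityMeasure ν] (hμ : IsUniformlyErgodicOn P K μ) (hν : P.Invariant ν)
    (hνK : ∀ᵐ x ∂ν, x ∈ K) : ν = μ := by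
  obtain ⟨r, C, hr, hr1, -, hconv⟩ := hμ
  refine Measure.ext fun A hA => ?_
  rw [← measureReal_eq_measureReal_iff]
  set φ : X → ℝ := A.indicator 1
  have hφm : Measurable φ := measurable_one.indicator hA
  have hφ1 (x : X) : |φ x| ≤ 1 := by
    by_cases hx : x ∈ A <;> simp [φ, hx]
  have hφ (η : Measure X) [IsProbabilityMeasure η] : Integrable φ η :=
    .of_bound hφm.aestronglyMeasurable 1 (ae_of_all _ hφ1)
  have hbound (t : ℕ) : |ν.real A - μ.real A| ≤ C * r ^ t := by
    have hpow := (invariant_pow hν t)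
    have hint : Integrable (fun x => ∫ y, φ y ∂(P ^ t) x) ν :=
      .of_bound hφm.stronglyMeasurable.integral_kernel.aestronglyMeasurable 1
        (ae_of_all _ fun x => (norm_integral_le_of_norm_le_const (ae_of_all _ hφ1)).trans_eq
          (by simp))
    have hmean : ν.real A - μ.real A = ∫ x, (∫ y, φ y ∂(P ^ t) x - ∫ y, φ y ∂μ) ∂ν := by
      rw [integral_sub hint (integrable_const _), integral_integral_of_invariant hpow (hφ ν)]
      simp [φ, integral_indicator_one hA]
    rw [hmean]
    have hle := norm_integral_le_of_norm_le_const (hνK.mono fun x hx =>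
      (Real.norm_eq_abs _).trans_le (hconv φ hφm 1 (fun y _ => hφ1 y) t x hx))
    simpa using hle
  have hlim : Tendsto (fun t : ℕ => C * r ^ t) atTop (𝓝 0) := by
    simpa using (tendsto_pow_atTop_nhds_zero_of_lt_one hr.le hr1).const_mul C
  exact sub_eq_zero.1 (abs_nonpos_iff.1 (ge_of_tendsto' hlim hbound))

/-! ### Existence of an invariant probability measure -/

/-- The law on the event of no regeneration up to time `j`, for the chain with kernel `Q` that
starts from `ν` and regenerates at rate `ν univ`, each time from the normalized `ν`. -/
noncomputable def regenerationTail (Q : Kernel X X) (ν : Measure X) : ℕ → Measure X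
  | 0 => ν
  | j + 1 => (regenerationTail Q ν j).bind Q - regenerationTail Q ν j univ • ν

theorem ae_mem_bind (hQ : IsAbsorbing Q K) (hK : MeasurableSet K) (hμ : ∀ᵐ x ∂μ, x ∈ K) :
    ∀ᵐ x ∂μ.bind Q, x ∈ K :=
  (Measure.ae_comp_iff hK).2 (hμ.mono hQ)

theorem ae_mem_regenerationTail (hQ : IsAbsorbing Q K) (hK : MeasurableSet K)
    (hν : ∀ᵐ x ∂ν, x ∈ K) (j : ℕ) : ∀ᵐ x ∂regenerationTail Q ν j, x ∈ K := by
  induction j with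
  | zero => exact hν
  | succ j ih => exact ae_mono Measure.sub_le (ae_mem_bind hQ hK ih)

theorem smul_le_bind (hν : ∀ x ∈ K, ν ≤ Q x) (hμ : ∀ᵐ x ∂μ, x ∈ K) :
    μ univ • ν ≤ μ.bind Q := Measure.le_iff.2 fun A hA => by
  rw [Measure.bind_apply hA Q.measurable.aemeasurable]
  calc μ univ • ν A = ∫⁻ _, ν A ∂μ := by rw [lintegral_const, smul_eq_mul, mul_comm]
    _ ≤ ∫⁻ x, Q x A ∂μ := lintegral_mono_ae (hμ.mono fun x hx => hν x hx A)

theorem regenerationTail_succ_add [IsFiniteMeasure ν] (hQ : IsAbsorbing Q K)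
    (hK : MeasurableSet K) (hν : ∀ x ∈ K, ν ≤ Q x)
    (hνK : ∀ᵐ x ∂ν, x ∈ K) (j : ℕ) [IsFiniteMeasure (regenerationTail Q ν j)] :
    regenerationTail Q ν (j + 1) + regenerationTail Q ν j univ • ν =
      (regenerationTail Q ν j).bind Q :=
  have : IsFiniteMeasure (regenerationTail Q ν j univ • ν) :=
    ν.smul_finite (measure_ne_top _ _)
  Measure.sub_add_cancel_of_le (smul_le_bind hν (ae_mem_regenerationTail hQ hK hνK j))

theorem regenerationTail_univ [IsMarkovKernel Q] (hQ : IsAbsorbing Q K) (hK : MeasurableSet K)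
    (hν : ∀ x ∈ K, ν ≤ Q x) (hνK : ∀ᵐ x ∂ν, x ∈ K) (hν1 : ν univ ≤ 1) (j : ℕ) :
    regenerationTail Q ν j univ = ν univ * (1 - ν univ) ^ j := by
  have : IsFiniteMeasure ν := ⟨hν1.trans_lt ENNReal.one_lt_top⟩
  induction j with
  | zero => simp [regenerationTail]
  | succ j ih =>
    have hfin : IsFiniteMeasure (regenerationTail Q ν j) :=
      ⟨by rw [ih]; finiteness⟩
    have hmass := congrArg (· univ) (regenerationTail_succ_add hQ hK hν hνK j)
    simp only [Measure.add_apply, Measure.smul_apply, smul_eq_mul, Measure.comp_apply_univ]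
      at hmass
    rw [ENNReal.eq_sub_of_add_eq (by finiteness) hmass, ih, pow_succ, ← mul_assoc,
      ENNReal.mul_sub (by finiteness), mul_one]

theorem exists_invariant_of_minorization [IsMarkovKernel Q] (hQ : IsAbsorbing Q K)
    (hK : MeasurableSet K) (hne : K.Nonempty) (hν : ∀ x ∈ K, ν ≤ Q x) (hν0 : ν ≠ 0) :
    ∃ μ : Measure X, IsProbabilityMeasure μ ∧ (∀ᵐ x ∂μ, x ∈ K) ∧ Q.Invariant μ := by
  obtain ⟨x₀, hx₀⟩ := hne
  have hνK : ∀ᵐ x ∂ν, x ∈ K := ae_mono (hν x₀ hx₀) (hQ x₀ hx₀)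
  have hν1 : ν univ ≤ 1 := (hν x₀ hx₀ univ).trans_eq measure_univ
  have hfin : IsFiniteMeasure ν := ⟨hν1.trans_lt ENNReal.one_lt_top⟩
  have hmass := regenerationTail_univ hQ hK hν hνK hν1
  have hfin' (j : ℕ) : IsFiniteMeasure (regenerationTail Q ν j) :=
    ⟨by rw [hmass]; finiteness⟩
  set μ : Measure X := Measure.sum (regenerationTail Q ν)
  have hμ1 : μ univ = 1 := by
    rw [Measure.sum_apply _ .univ, tsum_congr hmass, ENNReal.tsum_mul_left,
      ENNReal.tsum_geometric, ENNReal.sub_sub_cancel ENNReal.one_ne_top hν1]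
    exact ENNReal.mul_inv_cancel (Measure.measure_univ_ne_zero.2 hν0) (measure_ne_top _ _)
  refine ⟨μ, ⟨hμ1⟩, ?_, ?_⟩
  · exact Measure.ae_sum_iff.2 (ae_mem_regenerationTail hQ hK hνK)
  · refine Measure.ext fun A hA => ?_
    calc μ.bind Q A = ∑' j, (regenerationTail Q ν j).bind Q A := by
          rw [Measure.bind_sum _ _ Q.measurable.aemeasurable, Measure.sum_apply _ hA]
      _ = ∑' j, regenerationTail Q ν (j + 1) A + μ univ * ν A := by
          simp_rw [← regenerationTail_succ_add hQ hK hν hνK, Measure.add_apply,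
            Measure.smul_apply, smul_eq_mul, ENNReal.tsum_add, ENNReal.tsum_mul_right,
            μ, Measure.sum_apply _ MeasurableSet.univ]
      _ = μ A := by
          rw [hμ1, one_mul, Measure.sum_apply _ hA,
            tsum_eq_zero_add' (f := fun j => regenerationTail Q ν j A) ENNReal.summable, add_comm,
            regenerationTail]

theorem IsSmallSet.exists_invariant [IsMarkovKernel P] (hsmall : IsSmallSet P K)
    (hK : MeasurableSet K) (hne : K.Nonempty) (hP : IsAbsorbing P K) :
    ∃ μ : Measure X, IsProbabilityMeasure μ ∧ (∀ᵐ x ∂μ, x ∈ K) ∧ P.Invariant μ := by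
  obtain ⟨N, -, ν, hν, hle⟩ := hsmall
  obtain ⟨μ, hμ, hμK, hinv⟩ := exists_invariant_of_minorization (hP.pow hK N) hK hne hle hν
  have hsmallN : IsSmallSet (P ^ N) K := ⟨1, one_ne_zero, ν, hν, by simpa using hle⟩
  have hergodic := hsmallN.isUniformlyErgodicOn hK (hP.pow hK N) hinv hμK
  have hinv' : (P ^ N).Invariant (μ.bind P) := by
    have hcomm : (P ^ N) ∘ₖ P = P ∘ₖ (P ^ N) := (Commute.refl P).pow_left N
    rw [Kernel.Invariant, Measure.comp_assoc, hcomm, ← Measure.comp_assoc, hinv.def]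
  have hprob : IsProbabilityMeasure (μ.bind P) := ⟨by simp⟩
  exact ⟨μ, hμ, hμK, hergodic.eq_of_invariant hinv' (ae_mem_bind hP hK hμK)⟩

/-! ### Consequences of invariance -/

theorem ae_of_invariant_of_ae_ae (hμ : P.Invariant μ) (hK : MeasurableSet K)
    (h : ∀ᵐ x ∂μ, ∀ᵐ y ∂P x, y ∈ K) : ∀ᵐ x ∂μ, x ∈ K := by
  rw [← hμ.def]
  exact (Measure.ae_comp_iff hK).2 h

theorem integrable_integral_of_invariant (hμ : P.Invariant μ) {φ : X → ℝ}
    (hφ : Integrable φ μ) : Integrable (fun x => ∫ y, φ y ∂P x) μ := by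
  rw [← comp_const_of_invariant hμ] at hφ
  exact hφ.integral_comp

/-- A Lyapunov principle: `φ` and `∫ y, φ y ∂P x` have the same mean under `μ`. -/
theorem ae_eq_integral_of_invariant (hμ : P.Invariant μ) {φ : X → ℝ} (hφ : Integrable φ μ)
    (hle : ∀ᵐ x ∂μ, φ x ≤ ∫ y, φ y ∂P x) : ∀ᵐ x ∂μ, φ x = ∫ y, φ y ∂P x :=
  (integral_eq_iff_of_ae_le hφ (integrable_integral_of_invariant hμ hφ) hle).1
    (integral_integral_of_invariant hμ hφ).symm

theorem IsAbsorbing.ae_mem_of_invariant [IsMarkovKernel P] [IsFiniteMeasure μ]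
    (hP : IsAbsorbing P K) (hμ : P.Invariant μ) (hK : MeasurableSet K)
    (henter : ∀ᵐ x ∂μ, x ∉ K → P x K ≠ 0) : ∀ᵐ x ∂μ, x ∈ K := by
  have hind (x : X) : ∫ y, K.indicator 1 y ∂P x = (P x).real K := integral_indicator_one hK
  have hle (x : X) : K.indicator (1 : X → ℝ) x ≤ ∫ y, K.indicator 1 y ∂P x := by
    by_cases hx : x ∈ K
    · simp [hind, hx, Measure.real, (prob_compl_eq_zero_iff hK).1 (hP x hx)]
    · simp [hind, hx]
  have hint : Integrable (K.indicator (1 : X → ℝ)) μ := (integrable_const 1).indicator hK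
  filter_upwards [henter, ae_eq_integral_of_invariant hμ hint (ae_of_all _ hle)] with x hx heq
  by_contra hxK
  rw [hind, indicator_of_notMem hxK, eq_comm, measureReal_eq_zero_iff] at heq
  exact hx hxK heq

/-! ### Accessibility -/

/-- The points from which `P` reaches the set `V` with positive probability. -/
def accessible (P : Kernel X X) (V : Set X) : Set X := {x | ∃ n, (P ^ n) x V ≠ 0}

theorem subset_accessible {V : Set X} (hV : MeasurableSet V) : V ⊆ accessible P V :=
  fun x hx => ⟨0, by
    rw [show (P ^ 0) x V = V.indicator 1 x from Measure.dirac_apply' x hV, indicator_of_mem hx]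
    exact one_ne_zero⟩

theorem accessible_accessible_subset {V : Set X} (hV : MeasurableSet V) :
    accessible P (accessible P V) ⊆ accessible P V := by
  rintro x ⟨k, hk⟩
  by_contra hx
  simp only [accessible, mem_ofPred_eq, not_exists, not_not] at hx
  refine hk ?_
  have hnull (n : ℕ) : ∀ᵐ y ∂(P ^ k) x, (P ^ n) y V = 0 := by
    have h := hx (k + n)
    rwa [Kernel.pow_add_apply_eq_lintegral _ _ _ _ hV,
      lintegral_eq_zero_iff ((P ^ n).measurable_coe hV)] at h
  refine measure_mono_null (fun y hy => ?_) (ae_all_iff.2 hnull)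
  simpa [accessible] using hy

theorem measure_ne_zero_of_accessible {V : Set X} [NeZero μ] (hμ : P.Invariant μ)
    (hV : MeasurableSet V) (h : ∀ᵐ x ∂μ, x ∈ accessible P V) : μ V ≠ 0 := by
  intro h0
  have hnull (n : ℕ) : ∀ᵐ x ∂μ, (P ^ n) x V = 0 := by
    rw [← (invariant_pow hμ n).def, Measure.bind_apply hV (P ^ n).measurable.aemeasurable,
      lintegral_eq_zero_iff ((P ^ n).measurable_coe hV)] at h0
    exact h0
  obtain ⟨x, ⟨n, hn⟩, hx⟩ := (h.and (ae_all_iff.2 hnull)).exists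
  exact hn (hx n)

theorem pow_add_apply_ne_zero {B : Set X} (hB : MeasurableSet B) (hreturn : ∀ y ∈ B, P y B ≠ 0)
    {x : X} {n : ℕ} (hx : (P ^ n) x B ≠ 0) (k : ℕ) : (P ^ (n + k)) x B ≠ 0 := by
  induction k with
  | zero => exact hx
  | succ k ih =>
    rw [← add_assoc, Kernel.pow_succ_apply_eq_lintegral _ _ _ hB]
    intro h0
    rw [lintegral_eq_zero_iff (P.measurable_coe hB)] at h0
    exact ih (measure_mono_null (fun y hy => hreturn y hy) h0)

/-! ### The Feller property -/

section Feller

variable [TopologicalSpace X]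

/-- The Feller property, in the form that makes `P x V` lower semicontinuous in `x` for open `V`. -/
def IsFeller (P : Kernel X X) : Prop :=
  ∀ g : X → ℝ≥0∞, LowerSemicontinuous g → LowerSemicontinuous fun x => ∫⁻ y, g y ∂P x

variable [OpensMeasurableSpace X]

theorem IsFeller.lowerSemicontinuous_pow_apply (hP : IsFeller P) {V : Set X} (hV : IsOpen V)
    (n : ℕ) : LowerSemicontinuous fun x => (P ^ n) x V := by
  induction n with
  | zero =>
    have hdirac (x : X) : (P ^ 0) x V = V.indicator (fun _ => 1) x :=
      Measure.dirac_apply' x hV.measurableSet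
    simpa only [hdirac] using hV.lowerSemicontinuous_indicator zero_le_one
  | succ n ih =>
    simpa only [add_comm n 1, Kernel.pow_add_apply_eq_lintegral _ _ _ _ hV.measurableSet, pow_one]
      using hP _ ih

theorem IsFeller.isOpen_pow_apply_ne_zero (hP : IsFeller P) {V : Set X} (hV : IsOpen V) (n : ℕ) :
    IsOpen {x | (P ^ n) x V ≠ 0} := by
  simpa only [preimage, mem_Ioi, pos_iff_ne_zero] using
    (hP.lowerSemicontinuous_pow_apply hV n).isOpen_preimage 0

theorem IsFeller.isOpen_accessible (hP : IsFeller P) {V : Set X} (hV : IsOpen V) :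
    IsOpen (accessible P V) := by
  have hunion : accessible P V = ⋃ n, {x | (P ^ n) x V ≠ 0} := by
    ext x
    simp [accessible]
  rw [hunion]
  exact isOpen_iUnion fun n => hP.isOpen_pow_apply_ne_zero hV n

/-- If the open set `B` returns to itself in one step, the starting points that reach `B` in
exactly `n` steps form an increasing sequence of open sets; a single `n` then works for a compact
set of starting points. -/
theorem exists_pow_apply_ne_zero_of_isCompact (hP : IsFeller P) (hK : IsCompact K) {B : Set X}
    (hB : IsOpen B) (hreturn : ∀ y ∈ B, P y B ≠ 0) (hKB : K ⊆ accessible P B) :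
    ∃ n, ∀ x ∈ K, (P ^ n) x B ≠ 0 := by
  have hmono : Monotone fun n => {x | (P ^ n) x B ≠ 0} := fun m n hmn x hx => by
    obtain ⟨k, rfl⟩ := Nat.exists_eq_add_of_le hmn
    exact pow_add_apply_ne_zero hB.measurableSet hreturn hx k
  exact hK.elim_directed_cover _ (hP.isOpen_pow_apply_ne_zero hB)
    (fun x hx => mem_iUnion.2 (hKB hx)) hmono.directed_le

theorem isSmallSet_of_subset_accessible (hP : IsFeller P) (hK : IsCompact K) {B : Set X}
    (hB : IsOpen B) (hreturn : ∀ y ∈ B, P y B ≠ 0) (hKB : K ⊆ accessible P B) (hν : ν ≠ 0)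
    (hle : ∀ y ∈ B, ν ≤ P y) : IsSmallSet P K := by
  rcases K.eq_empty_or_nonempty with rfl | hne
  · exact ⟨1, one_ne_zero, ν, hν, by simp⟩
  obtain ⟨n, hn⟩ := exists_pow_apply_ne_zero_of_isCompact hP hK hB hreturn hKB
  obtain ⟨x₀, hx₀, hmin⟩ := LowerSemicontinuousOn.exists_isMinOn hne hK
    ((hP.lowerSemicontinuous_pow_apply hB n).lowerSemicontinuousOn K)
  refine ⟨n + 1, n.succ_ne_zero, (P ^ n) x₀ B • ν, ?_, fun x hx => Measure.le_iff.2 fun A hA => ?_⟩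
  · rw [← Measure.measure_univ_ne_zero]
    exact mul_ne_zero (hn x₀ hx₀) (Measure.measure_univ_ne_zero.2 hν)
  · calc (P ^ n) x₀ B * ν A ≤ (P ^ n) x B * ν A := mul_le_mul_left (isMinOn_iff.1 hmin x hx) _
      _ = ∫⁻ _ in B, ν A ∂(P ^ n) x := by rw [setLIntegral_const, mul_comm]
      _ ≤ ∫⁻ y in B, P y A ∂(P ^ n) x :=
        setLIntegral_mono (P.measurable_coe hA) fun y hy => hle y hy A
      _ ≤ ∫⁻ y, P y A ∂(P ^ n) x := setLIntegral_le_lintegral _ _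
      _ = (P ^ (n + 1)) x A := (Kernel.pow_succ_apply_eq_lintegral _ _ _ hA).symm

end Feller

/-! ### Transition densities -/

section TransitionDensity

variable {p : X → X → ℝ} {ρ m : Measure X}

/-- The transition laws `P x` have densities `p x` with respect to `m`, for `ρ`-almost every
starting point `x`. -/
structure HasTransitionDensity (P : Kernel X X) (p : X → X → ℝ) (ρ m : Measure X) : Prop where
  aestronglyMeasurable : AEStronglyMeasurable (Function.uncurry p) (ρ.prod m)
  ae_nonneg : ∀ᵐ x ∂ρ, ∀ y, 0 ≤ p x y
  ae_eq : ∀ᵐ x ∂ρ, P x = m.withDensity fun y => ENNReal.ofReal (p x y)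

theorem HasTransitionDensity.ae_integral_eq [SFinite m] (hp : HasTransitionDensity P p ρ m) :
    ∀ᵐ x ∂ρ, ∀ φ : X → ℝ, ∫ y, φ y ∂P x = ∫ y, p x y * φ y ∂m := by
  filter_upwards [hp.ae_nonneg, hp.ae_eq, hp.aestronglyMeasurable.prodMk_left] with x h0 heq hm φ
  have hm' : AEMeasurable (fun y => ENNReal.ofReal (p x y)) m := hm.aemeasurable.ennreal_ofReal
  rw [heq, integral_withDensity_eq_integral_toReal_smul₀ hm'
    (ae_of_all _ fun _ => ENNReal.ofReal_lt_top)]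
  exact integral_congr_ae (ae_of_all _ fun y => by
    simp only [ENNReal.toReal_ofReal (h0 y), smul_eq_mul])

theorem HasTransitionDensity.ae_integrable [IsMarkovKernel P] [SFinite m]
    (hp : HasTransitionDensity P p ρ m) :
    ∀ᵐ x ∂ρ, Integrable (p x) m ∧ ∫ y, p x y ∂m = 1 := by
  filter_upwards [hp.ae_nonneg, hp.ae_eq, hp.aestronglyMeasurable.prodMk_left,
    hp.ae_integral_eq] with x h0 heq hm hint
  refine ⟨(lintegral_ofReal_ne_top_iff_integrable hm (ae_of_all _ h0)).1 ?_, ?_⟩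
  · have hmass : P x univ = 1 := measure_univ
    rw [heq, withDensity_apply _ .univ, Measure.restrict_univ] at hmass
    exact hmass.trans_ne ENNReal.one_ne_top
  · simpa using (hint 1).symm

theorem HasTransitionDensity.integrable_mul [IsMarkovKernel P] [SFinite m]
    (hp : HasTransitionDensity P p ρ m) {f : X → ℝ} (hf : Integrable f ρ) :
    Integrable (fun z : X × X => p z.1 z.2 * f z.1) (ρ.prod m) := by
  refine (integrable_prod_iff (hp.aestronglyMeasurable.mul hf.1.comp_fst)).2 ⟨?_, ?_⟩
  · filter_upwards [hp.ae_integrable] with x hx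
    exact hx.1.mul_const (f x)
  · refine hf.abs.congr ?_
    filter_upwards [hp.ae_integrable, hp.ae_nonneg] with x hx h0
    change |f x| = ∫ y, ‖p x y * f x‖ ∂m
    simp only [norm_mul, Real.norm_of_nonneg (h0 _), Real.norm_eq_abs, integral_mul_const, hx.2,
      one_mul]

theorem HasTransitionDensity.eq_withDensity_of_invariant [SFinite ν] [SFinite m]
    (hp : HasTransitionDensity P p ν m) (hν : P.Invariant ν) :
    ν = m.withDensity fun y => ∫⁻ x, ENNReal.ofReal (p x y) ∂ν := by
  refine Measure.ext fun A hA => ?_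
  have hmeas : AEMeasurable (Function.uncurry fun x y => ENNReal.ofReal (p x y))
      (ν.prod (m.restrict A)) :=
    (hp.aestronglyMeasurable.mono_ac
      (Measure.AbsolutelyContinuous.rfl.prod Measure.restrict_le_self.absolutelyContinuous)
      ).aemeasurable.ennreal_ofReal
  calc ν A = ∫⁻ x, P x A ∂ν := by
        conv_lhs => rw [← hν.def, Measure.bind_apply hA P.measurable.aemeasurable]
    _ = ∫⁻ x, ∫⁻ y in A, ENNReal.ofReal (p x y) ∂m ∂ν :=
      lintegral_congr_ae (hp.ae_eq.mono fun x hx => by dsimp only; rw [hx, withDensity_apply _ hA])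
    _ = ∫⁻ y in A, ∫⁻ x, ENNReal.ofReal (p x y) ∂ν ∂m := lintegral_lintegral_swap hmeas
    _ = _ := (withDensity_apply _ hA).symm

/-- The Markov operator on densities with respect to `m` of a chain with transition densities
`p x`. -/
noncomputable def transferOp (m : Measure X) (p : X → X → ℝ) (f : X → ℝ) (y : X) : ℝ :=
  ∫ x, p x y * f x ∂m

variable [IsMarkovKernel P] [SFinite m] {f φ : X → ℝ} {M : ℝ}

theorem HasTransitionDensity.integrable_transferOp (hp : HasTransitionDensity P p m m)
    (hf : Integrable f m) : Integrable (transferOp m p f) m :=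
  (hp.integrable_mul hf).integral_prod_right

theorem HasTransitionDensity.integral_transferOp_mul (hp : HasTransitionDensity P p m m)
    (hf : Integrable f m) (hφ : Measurable φ) (hM : ∀ x, |φ x| ≤ M) :
    ∫ y, transferOp m p f y * φ y ∂m = ∫ x, f x * ∫ y, φ y ∂P x ∂m := by
  have hint : Integrable (fun z : X × X => p z.1 z.2 * f z.1 * φ z.2) (m.prod m) :=
    (hp.integrable_mul hf).mul_bdd (c := M) (hφ.comp measurable_snd).aestronglyMeasurable
      (ae_of_all _ fun z => hM z.2)
  calc ∫ y, transferOp m p f y * φ y ∂m = ∫ y, ∫ x, p x y * f x * φ y ∂m ∂m := by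
        simp only [transferOp, integral_mul_const]
    _ = ∫ x, ∫ y, p x y * f x * φ y ∂m ∂m :=
      (integral_integral_swap (f := fun x y => p x y * f x * φ y) hint).symm
    _ = ∫ x, f x * ∫ y, φ y ∂P x ∂m := by
      refine integral_congr_ae ?_
      filter_upwards [hp.ae_integral_eq] with x hx
      rw [hx, ← integral_const_mul]
      exact integral_congr_ae (ae_of_all _ fun y => by ring)

theorem HasTransitionDensity.integrable_iterate_transferOp (hp : HasTransitionDensity P p m m)
    (hf : Integrable f m) (t : ℕ) : Integrable ((transferOp m p)^[t] f) m := by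
  induction t with
  | zero => exact hf
  | succ t ih => rw [Function.iterate_succ_apply']; exact hp.integrable_transferOp ih

theorem abs_integral_le_of_abs_le [IsProbabilityMeasure μ] (hM : ∀ x, |φ x| ≤ M) :
    |∫ x, φ x ∂μ| ≤ M := by
  simpa using norm_integral_le_of_norm_le_const (μ := μ) (f := φ) (ae_of_all _ hM)

theorem HasTransitionDensity.integral_iterate_transferOp_mul (hp : HasTransitionDensity P p m m)
    (hf : Integrable f m) (hφ : Measurable φ) (hM : ∀ x, |φ x| ≤ M) (t : ℕ) :
    ∫ y, (transferOp m p)^[t] f y * φ y ∂m = ∫ x, f x * ∫ y, φ y ∂(P ^ t) x ∂m := by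
  induction t generalizing f with
  | zero =>
    have hone (x : X) : ∫ y, φ y ∂(P ^ 0) x = φ x := integral_dirac' φ x hφ.stronglyMeasurable
    simp only [hone, Function.iterate_zero_apply]
  | succ t ih =>
    rw [Function.iterate_succ_apply, ih (hp.integrable_transferOp hf),
      hp.integral_transferOp_mul hf hφ.stronglyMeasurable.integral_kernel.measurable
        fun x => abs_integral_le_of_abs_le hM, pow_succ]
    have hcomp (x : X) : ∫ y, φ y ∂(P ^ t * P) x = ∫ y, ∫ z, φ z ∂(P ^ t) y ∂P x :=
      integral_mul_apply (.of_bound hφ.aestronglyMeasurable M (ae_of_all _ hM))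
    simp only [hcomp]

theorem HasTransitionDensity.exists_abs_integral_iterate_transferOp_sub_le
    (hp : HasTransitionDensity P p m m) (hP : IsUniformlyErgodicOn P K μ) :
    ∃ r C : ℝ, 0 < r ∧ r < 1 ∧ 0 < C ∧ ∀ f φ : X → ℝ, Integrable f m → (∀ x ∉ K, f x = 0) →
      Measurable φ → ∀ M, (∀ x, |φ x| ≤ M) → ∀ t : ℕ,
        |∫ y, (transferOp m p)^[t] f y * φ y ∂m - (∫ x, f x ∂m) * ∫ x, φ x ∂μ| ≤
          C * r ^ t * (∫ x, |f x| ∂m) * M := by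
  obtain ⟨r, C, hr, hr1, hC, hconv⟩ := hP
  refine ⟨r, C, hr, hr1, hC, fun f φ hf hfK hφ M hM t => ?_⟩
  have hmeas : Measurable fun x => ∫ y, φ y ∂(P ^ t) x :=
    hφ.stronglyMeasurable.integral_kernel.measurable
  have hint : Integrable (fun x => f x * ∫ y, φ y ∂(P ^ t) x) m :=
    hf.mul_bdd (c := M) hmeas.aestronglyMeasurable
      (ae_of_all _ fun x => abs_integral_le_of_abs_le hM)
  have hpoint (x : X) :
      ‖f x * ∫ y, φ y ∂(P ^ t) x - f x * ∫ y, φ y ∂μ‖ ≤ |f x| * (C * r ^ t * M) := by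
    rw [← mul_sub, norm_mul, Real.norm_eq_abs, Real.norm_eq_abs]
    by_cases hx : x ∈ K
    · exact mul_le_mul_of_nonneg_left (hconv φ hφ M (fun y _ => hM y) t x hx) (abs_nonneg _)
    · simp [hfK x hx]
  rw [hp.integral_iterate_transferOp_mul hf hφ hM, ← integral_mul_const,
    ← integral_sub hint (hf.mul_const _)]
  calc _ ≤ ∫ x, |f x| * (C * r ^ t * M) ∂m :=
        norm_integral_le_of_norm_le (hf.abs.mul_const _) (ae_of_all _ hpoint)
    _ = C * r ^ t * (∫ x, |f x| ∂m) * M := by rw [integral_mul_const]; ring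

end TransitionDensity

end MarkovKernel

/-! ### Random maps -/

section RandomMap

variable {X Y : Type*} [MeasurableSpace X] [MeasurableSpace Y] {F : X × Y → X} {ν : Measure Y}

/-- The Markov kernel of the chain that moves from `x` to `F (x, y)` with `y` drawn from `ν`. It
is the zero kernel if `F` is not measurable. -/
noncomputable def randomMapKernel (F : X × Y → X) (ν : Measure Y) : Kernel X X :=
  (Kernel.id ×ₖ Kernel.const X ν).map F

theorem randomMapKernel_apply [SFinite ν] (hF : Measurable F) (x : X) :
    randomMapKernel F ν x = ν.map fun y => F (x, y) := by
  rw [randomMapKernel, Kernel.map_apply _ hF, Kernel.prod_apply, Kernel.id_apply,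
    Kernel.const_apply, Measure.dirac_prod, Measure.map_map hF measurable_prodMk_left]
  rfl

theorem isMarkovKernel_randomMapKernel [IsProbabilityMeasure ν] (hF : Measurable F) :
    IsMarkovKernel (randomMapKernel F ν) := by
  unfold randomMapKernel
  exact Kernel.IsMarkovKernel.map _ hF

theorem isFeller_randomMapKernel [TopologicalSpace X] [FirstCountableTopology X]
    [OpensMeasurableSpace X] [SFinite ν] (hF : Measurable F)
    (hcont : ∀ y, Continuous fun x => F (x, y)) : IsFeller (randomMapKernel F ν) := by
  intro g hg
  have hFx (x : X) : Measurable fun y => F (x, y) := hF.comp measurable_prodMk_left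
  have hlint (x : X) : ∫⁻ z, g z ∂randomMapKernel F ν x = ∫⁻ y, g (F (x, y)) ∂ν := by
    rw [randomMapKernel_apply hF, lintegral_map hg.measurable (hFx x)]
  simp only [hlint, lowerSemicontinuous_iff_le_liminf]
  intro x
  calc ∫⁻ y, g (F (x, y)) ∂ν ≤ ∫⁻ y, liminf (fun x' => g (F (x', y))) (𝓝 x) ∂ν :=
        lintegral_mono fun y =>
          lowerSemicontinuous_iff_le_liminf.1 (hg.comp (hcont y)) x
    _ ≤ liminf (fun x' => ∫⁻ y, g (F (x', y)) ∂ν) (𝓝 x) :=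
      lintegral_liminf_le' fun x' =>
        (hg.measurable.comp (hFx x')).aemeasurable

end RandomMap

/-! ### The noise -/

section Noise

variable {χ : ℝ → ℝ} {a : ℝ}

theorem IsBump.exists_mem_pos (hχ : IsBump χ a) {V : Set ℝ} (hV : IsOpen V) {u : ℝ} (huV : u ∈ V)
    (hu : u ∈ Icc (-a) a) : ∃ v ∈ V, 0 < χ v := by
  rw [← hχ.tsupport_eq] at hu
  obtain ⟨v, hvV, hv⟩ := mem_closure_iff.1 hu V hV huV
  exact ⟨v, hvV, (hχ.nonneg v).lt_of_ne' hv⟩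

theorem IsBump.noiseDensity_nonneg (hχ : IsBump χ a) (y : ℝ) : 0 ≤ noiseDensity χ y := by
  have hweight (u : ℝ) : 0 ≤ χ u * Real.exp (-u ^ 2 / 2) :=
    mul_nonneg (hχ.nonneg u) (Real.exp_pos _).le
  exact mul_nonneg (inv_nonneg.2 (integral_nonneg hweight)) (hweight y)

theorem IsBump.contDiff_noiseDensity (hχ : IsBump χ a) :
    ContDiff ℝ ((⊤ : ℕ∞) : WithTop ℕ∞) (noiseDensity χ) := by
  have := hχ.smooth
  unfold noiseDensity
  fun_prop

theorem IsBump.continuous_noiseDensity (hχ : IsBump χ a) : Continuous (noiseDensity χ) :=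
  hχ.contDiff_noiseDensity.continuous

theorem IsBump.hasCompactSupport_weight (hχ : IsBump χ a) :
    HasCompactSupport fun u => χ u * Real.exp (-u ^ 2 / 2) := by
  have h : HasCompactSupport χ := by
    rw [HasCompactSupport, hχ.tsupport_eq]
    exact isCompact_Icc
  exact h.mul_right

theorem IsBump.integral_weight_pos (hχ : IsBump χ a) (ha : 0 < a) :
    0 < ∫ u, χ u * Real.exp (-u ^ 2 / 2) := by
  obtain ⟨u, -, hu⟩ := hχ.exists_mem_pos isOpen_univ (mem_univ 0) ⟨neg_nonpos.2 ha.le, ha.le⟩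
  have := hχ.smooth.continuous
  exact Continuous.integral_pos_of_hasCompactSupport_nonneg_nonzero (by fun_prop)
    hχ.hasCompactSupport_weight (fun v => mul_nonneg (hχ.nonneg v) (Real.exp_pos _).le)
    (mul_pos hu (Real.exp_pos _)).ne'

theorem IsBump.noiseDensity_pos (hχ : IsBump χ a) (ha : 0 < a) {y : ℝ} (hy : 0 < χ y) :
    0 < noiseDensity χ y :=
  mul_pos (inv_pos.2 (hχ.integral_weight_pos ha)) (mul_pos hy (Real.exp_pos _))

theorem IsBump.hasCompactSupport_noiseDensity (hχ : IsBump χ a) :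
    HasCompactSupport (noiseDensity χ) :=
  hχ.hasCompactSupport_weight.mul_left

theorem IsBump.exists_lipschitzWith_noiseDensity (hχ : IsBump χ a) :
    ∃ L, LipschitzWith L (noiseDensity χ) :=
  hχ.contDiff_noiseDensity.lipschitzWith_of_hasCompactSupport hχ.hasCompactSupport_noiseDensity
    (by simp)

theorem IsBump.isProbabilityMeasure_noiseLaw (hχ : IsBump χ a) (ha : 0 < a) :
    IsProbabilityMeasure (noiseLaw χ) := by
  have hint : Integrable (noiseDensity χ) :=
    hχ.continuous_noiseDensity.integrable_of_hasCompactSupport hχ.hasCompactSupport_noiseDensity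
  have hone : ∫ y, noiseDensity χ y = 1 := by
    simp only [noiseDensity, integral_const_mul, inv_mul_cancel₀ (hχ.integral_weight_pos ha).ne']
  constructor
  rw [noiseLaw, withDensity_apply _ .univ, Measure.restrict_univ,
    ← ofReal_integral_eq_lintegral_ofReal hint (ae_of_all _ hχ.noiseDensity_nonneg), hone,
    ENNReal.ofReal_one]

theorem IsBump.ae_mem_noiseLaw (hχ : IsBump χ a) : ∀ᵐ u ∂noiseLaw χ, u ∈ Icc (-a) a := by
  rw [noiseLaw, ae_withDensity_iff hχ.continuous_noiseDensity.measurable.ennreal_ofReal]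
  refine ae_of_all _ fun u => not_imp_comm.1 fun hu => ?_
  have hzero : χ u = 0 := image_eq_zero_of_notMem_tsupport (hχ.tsupport_eq ▸ hu)
  simp [noiseDensity, hzero]

theorem IsBump.noiseLaw_ne_zero (hχ : IsBump χ a) (ha : 0 < a) {V : Set ℝ} (hV : IsOpen V)
    {u : ℝ} (huV : u ∈ V) (hu : u ∈ Icc (-a) a) : noiseLaw χ V ≠ 0 := by
  obtain ⟨v, hvV, hv⟩ := hχ.exists_mem_pos hV huV hu
  have hopen : IsOpen (V ∩ {y | 0 < noiseDensity χ y}) :=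
    hV.inter (isOpen_lt continuous_const hχ.continuous_noiseDensity)
  have hpos := hopen.measure_ne_zero volume ⟨v, hvV, hχ.noiseDensity_pos ha hv⟩
  contrapose! hpos
  rw [noiseLaw, withDensity_apply_eq_zero
    hχ.continuous_noiseDensity.measurable.ennreal_ofReal] at hpos
  refine measure_mono_null (inter_comm _ _ |>.le.trans (inter_subset_inter_left _ ?_)) hpos
  exact fun y hy => (ENNReal.ofReal_pos.2 hy).ne'

end Noise

/-! ### Transition probabilities of the perturbed map -/

section Transition

variable {T s χ : ℝ → ℝ} {a : ℝ}

/-- The kernel of the chain that moves from `x` to `T x + s x * Y` with noise `Y` of density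
`noiseDensity χ`, on the whole real line. Its transition laws are `transition T s χ x` if `T` and
`s` are measurable. -/
noncomputable def transitionKernel (T s χ : ℝ → ℝ) : Kernel ℝ ℝ :=
  randomMapKernel (fun z : ℝ × ℝ => T z.1 + s z.1 * z.2) (noiseLaw χ)

theorem measurable_noise_step (hT : Measurable T) (hs : Measurable s) :
    Measurable fun z : ℝ × ℝ => T z.1 + s z.1 * z.2 := by
  fun_prop

instance sFinite_noiseLaw : SFinite (noiseLaw χ) := by
  unfold noiseLaw; infer_instance

theorem transitionKernel_apply (hT : Measurable T) (hs : Measurable s) (x : ℝ) :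
    transitionKernel T s χ x = transition T s χ x :=
  randomMapKernel_apply (measurable_noise_step hT hs) x

theorem isMarkovKernel_transitionKernel (hχ : IsBump χ a) (ha : 0 < a) (hT : Measurable T)
    (hs : Measurable s) : IsMarkovKernel (transitionKernel T s χ) :=
  have := hχ.isProbabilityMeasure_noiseLaw ha
  isMarkovKernel_randomMapKernel (measurable_noise_step hT hs)

theorem isFeller_transitionKernel (hT : Continuous T) (hs : Continuous s) :
    IsFeller (transitionKernel T s χ) :=
  isFeller_randomMapKernel (measurable_noise_step hT.measurable hs.measurable) fun y => by fun_prop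

theorem ae_mem_transition (hχ : IsBump χ a) {K : Set ℝ} (hK : MeasurableSet K) {x : ℝ}
    (h : ∀ u ∈ Icc (-a) a, T x + s x * u ∈ K) : ∀ᵐ y ∂transition T s χ x, y ∈ K :=
  (ae_map_iff (by fun_prop) hK).2 (hχ.ae_mem_noiseLaw.mono h)

theorem transition_ne_zero (hχ : IsBump χ a) (ha : 0 < a) {V : Set ℝ} (hV : IsOpen V) {x u : ℝ}
    (hu : u ∈ Icc (-a) a) (huV : T x + s x * u ∈ V) : transition T s χ x V ≠ 0 := by
  rw [transition, Measure.map_apply (by fun_prop) hV.measurableSet]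
  exact hχ.noiseLaw_ne_zero ha (hV.preimage (by fun_prop)) huV hu

theorem transition_ne_zero_of_dist_lt (hχ : IsBump χ a) (ha : 0 < a) {V : Set ℝ} (hV : IsOpen V)
    {x v : ℝ} (hs : 0 < s x) (hv : |v - T x| < a * s x) (hvV : v ∈ V) :
    transition T s χ x V ≠ 0 := by
  have hu : (v - T x) / s x ∈ Icc (-a) a := by
    rw [mem_Icc, ← abs_le, abs_div, abs_of_pos hs, div_le_iff₀ hs]
    exact hv.le
  exact transition_ne_zero hχ ha hV hu (by rwa [mul_div_cancel₀ _ hs.ne', add_sub_cancel])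

theorem smul_map_volume_affine (b : ℝ) {c : ℝ} (hc : c ≠ 0) :
    (ENNReal.ofReal |c| • (volume : Measure ℝ).map fun u => b + c * u) = volume := by
  have hcomp : (fun u => b + c * u) = (b + ·) ∘ (c * ·) := rfl
  rw [hcomp, ← Measure.map_map (by fun_prop) (by fun_prop), ← Measure.map_smul,
    Real.smul_map_volume_mul_left hc, map_add_left_eq_self]

theorem transition_eq_withDensity (hχ : IsBump χ a) {x : ℝ} (hs : 0 < s x) :
    transition T s χ x = volume.withDensity fun y => ENNReal.ofReal (kernelDensity T s χ x y) := by
  have hstep : Measurable fun u => T x + s x * u := by fun_prop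
  have hcont := hχ.continuous_noiseDensity
  have hmeas : Measurable fun y => ENNReal.ofReal (kernelDensity T s χ x y) := by
    unfold kernelDensity; fun_prop
  have hdensity (u : ℝ) : ENNReal.ofReal (s x) *
      ENNReal.ofReal (kernelDensity T s χ x (T x + s x * u)) =
        ENNReal.ofReal (noiseDensity χ u) := by
    rw [← ENNReal.ofReal_mul hs.le, kernelDensity, add_sub_cancel_left,
      mul_div_cancel_left₀ _ hs.ne', mul_inv_cancel_left₀ hs.ne']
  refine Measure.ext fun A hA => ?_
  rw [transition, Measure.map_apply hstep hA, noiseLaw, withDensity_apply _ (hstep hA),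
    withDensity_apply _ hA]
  conv_rhs => rw [← smul_map_volume_affine (T x) hs.ne', abs_of_pos hs, Measure.restrict_smul,
    lintegral_smul_measure, setLIntegral_map hA hmeas hstep, smul_eq_mul]
  rw [← lintegral_const_mul' _ _ ENNReal.ofReal_ne_top]
  simp only [hdensity]

/-! ### The kernel density -/

theorem kernelDensity_nonneg (hχ : IsBump χ a) {x : ℝ} (hs : 0 ≤ s x) (y : ℝ) :
    0 ≤ kernelDensity T s χ x y :=
  mul_nonneg (inv_nonneg.2 hs) (hχ.noiseDensity_nonneg _)

theorem kernelDensity_pos_iff {x u : ℝ} (hs : 0 < s x) :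
    0 < kernelDensity T s χ x (T x + s x * u) ↔ 0 < noiseDensity χ u := by
  rw [kernelDensity, add_sub_cancel_left, mul_div_cancel_left₀ _ hs.ne',
    mul_pos_iff_of_pos_left (inv_pos.2 hs)]

theorem measurable_uncurry_kernelDensity (hχ : IsBump χ a) (hT : Measurable T)
    (hs : Measurable s) : Measurable (Function.uncurry (kernelDensity T s χ)) := by
  have := hχ.continuous_noiseDensity.measurable
  unfold Function.uncurry kernelDensity
  fun_prop

theorem continuousAt_uncurry_kernelDensity (hχ : IsBump χ a) {x : ℝ} (hT : ContinuousAt T x)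
    (hs : ContinuousAt s x) (hx : s x ≠ 0) (y : ℝ) :
    ContinuousAt (Function.uncurry (kernelDensity T s χ)) (x, y) := by
  have hT' : ContinuousAt (fun z : ℝ × ℝ => T z.1) (x, y) := hT.comp continuousAt_fst
  have hs' : ContinuousAt (fun z : ℝ × ℝ => s z.1) (x, y) := hs.comp continuousAt_fst
  exact (hs'.inv₀ hx).mul
    (hχ.continuous_noiseDensity.continuousAt.comp ((continuousAt_snd.sub hT').div hs' hx))

theorem exists_kernelDensity_le (hχ : IsBump χ a) {s₀ : ℝ} (hs₀ : 0 < s₀) :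
    ∃ M, ∀ T s : ℝ → ℝ, ∀ x, s₀ ≤ s x → ∀ y, |kernelDensity T s χ x y| ≤ M := by
  obtain ⟨M, hM⟩ :=
    hχ.hasCompactSupport_noiseDensity.exists_bound_of_continuous hχ.continuous_noiseDensity
  refine ⟨s₀⁻¹ * M, fun T s x hx y => ?_⟩
  rw [kernelDensity, abs_mul, abs_of_pos (inv_pos.2 (hs₀.trans_le hx))]
  gcongr
  exact hM _

theorem exists_lipschitzWith_kernelDensity (hχ : IsBump χ a) {s₀ : ℝ} (hs₀ : 0 < s₀) :
    ∃ M, ∀ T s : ℝ → ℝ, ∀ x, s₀ ≤ s x → LipschitzWith M (kernelDensity T s χ x) := by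
  obtain ⟨L, hL⟩ := hχ.exists_lipschitzWith_noiseDensity
  refine ⟨Real.toNNReal (s₀⁻¹ * (L * s₀⁻¹)), fun T s x hx =>
    LipschitzWith.of_dist_le' fun y z => ?_⟩
  have hs : 0 < s x := hs₀.trans_le hx
  have hscaled : |noiseDensity χ ((y - T x) / s x) - noiseDensity χ ((z - T x) / s x)| ≤
      L * (|y - z| * (s x)⁻¹) := by
    have h := hL.dist_le_mul ((y - T x) / s x) ((z - T x) / s x)
    rwa [Real.dist_eq, Real.dist_eq, ← sub_div, sub_sub_sub_cancel_right, abs_div, abs_of_pos hs,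
      div_eq_mul_inv] at h
  calc |kernelDensity T s χ x y - kernelDensity T s χ x z|
      = (s x)⁻¹ * |noiseDensity χ ((y - T x) / s x) - noiseDensity χ ((z - T x) / s x)| := by
        rw [kernelDensity, kernelDensity, ← mul_sub, abs_mul, abs_of_pos (inv_pos.2 hs)]
    _ ≤ (s x)⁻¹ * (L * (|y - z| * (s x)⁻¹)) := by gcongr
    _ ≤ s₀⁻¹ * (L * (|y - z| * s₀⁻¹)) := by gcongr
    _ = s₀⁻¹ * (L * s₀⁻¹) * |y - z| := by ring

end Transition

/-! ### Minorants and stationary densities -/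

section Density

theorem exists_minorant_of_continuousAt {X Y : Type*} [TopologicalSpace X] [TopologicalSpace Y]
    [MeasurableSpace Y] [OpensMeasurableSpace Y] {m : Measure Y} [m.IsOpenPosMeasure]
    {P : X → Measure Y} {p : X → Y → ℝ} {x₀ : X} {y₀ : Y}
    (hp : ContinuousAt (Function.uncurry p) (x₀, y₀)) (hpos : 0 < p x₀ y₀)
    (hP : ∀ᶠ x in 𝓝 x₀, P x = m.withDensity fun y => ENNReal.ofReal (p x y)) :
    ∃ ν : Measure Y, ν ≠ 0 ∧ ∀ᶠ x in 𝓝 x₀, ν ≤ P x := by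
  obtain ⟨U, hU, W, hW, hUW⟩ :=
    mem_nhds_prod_iff.1 (hp.eventually_const_lt (half_lt_self hpos))
  obtain ⟨W', hW'W, hW', hyW'⟩ := mem_nhds_iff.1 hW
  refine ⟨ENNReal.ofReal (p x₀ y₀ / 2) • m.restrict W', ?_, ?_⟩
  · rw [← Measure.measure_univ_ne_zero, Measure.smul_apply, Measure.restrict_apply_univ]
    exact mul_ne_zero (ENNReal.ofReal_pos.2 (half_pos hpos)).ne' (hW'.measure_ne_zero m ⟨y₀, hyW'⟩)
  · filter_upwards [hU, hP] with x hx hPx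
    rw [hPx]
    refine Measure.le_iff.2 fun A hA => ?_
    rw [withDensity_apply _ hA, Measure.smul_apply, Measure.restrict_apply hA, smul_eq_mul,
      ← setLIntegral_const]
    refine (setLIntegral_mono' (hA.inter hW'.measurableSet) fun y hy => ?_).trans
      (lintegral_mono_set inter_subset_left)
    exact ENNReal.ofReal_le_ofReal (hUW (mk_mem_prod hx (hW'W hy.2))).le

theorem lipschitzWith_integral {X Y : Type*} [MeasurableSpace X] [PseudoMetricSpace Y]
    {μ : Measure X} [IsProbabilityMeasure μ] {p : X → Y → ℝ} {M : NNReal}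
    (hp : ∀ y, Integrable (fun x => p x y) μ) (hM : ∀ᵐ x ∂μ, LipschitzWith M (p x)) :
    LipschitzWith M fun y => ∫ x, p x y ∂μ := by
  refine LipschitzWith.of_dist_le_mul fun y z => ?_
  rw [Real.dist_eq, ← integral_sub (hp y) (hp z), ← Real.norm_eq_abs]
  have hdist : ∀ᵐ x ∂μ, ‖p x y - p x z‖ ≤ M * dist y z := hM.mono fun x hx => hx.dist_le_mul y z
  simpa only [probReal_univ, mul_one] using norm_integral_le_of_norm_le_const hdist

end Density

/-! ### Functions of bounded variation -/

section BoundedVariation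

variable {g : ℝ → ℝ} {l b x : ℝ}

theorem measurable_indicator_of_monotoneOn (hg : MonotoneOn g (Icc l b)) :
    Measurable ((Icc l b).indicator g) := by
  rcases lt_or_ge b l with hlb | hlb
  · simp [Icc_eq_empty_of_lt hlb]
  have hmono : Monotone ((Icc l b).domRestrict g) := fun x y hxy => hg x.2 y.2 hxy
  rw [indicator_congr (g := IccExtend hlb ((Icc l b).domRestrict g)) fun x hx =>
    (IccExtend_of_mem hlb ((Icc l b).domRestrict g) hx).symm]
  exact (hmono.IccExtend hlb).measurable.indicator measurableSet_Icc

theorem measurable_indicator_of_boundedVariationOn (hg : BoundedVariationOn g (Icc l b)) :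
    Measurable ((Icc l b).indicator g) := by
  obtain ⟨p, q, hp, hq, rfl⟩ := hg.locallyBoundedVariationOn.exists_monotoneOn_sub_monotoneOn
  rw [indicator_sub']
  exact (measurable_indicator_of_monotoneOn hp).sub (measurable_indicator_of_monotoneOn hq)

theorem abs_le_abs_add_eVariationOn {s : Set ℝ} (hg : BoundedVariationOn g s) {y : ℝ}
    (hx : x ∈ s) (hy : y ∈ s) : |g x| ≤ |g y| + (eVariationOn g s).toReal := by
  have hdist := hg.dist_le hx hy
  rw [Real.dist_eq] at hdist
  linarith [abs_sub_abs_le_abs_sub (g x) (g y)]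

theorem integrableOn_of_boundedVariationOn (hg : BoundedVariationOn g (Icc l b)) :
    IntegrableOn g (Icc l b) := by
  rcases lt_or_ge b l with hlb | hlb
  · simp [Icc_eq_empty_of_lt hlb]
  have hm : AEStronglyMeasurable g (volume.restrict (Icc l b)) :=
    (aestronglyMeasurable_indicator_iff measurableSet_Icc).1
      (measurable_indicator_of_boundedVariationOn hg).aestronglyMeasurable
  exact Integrable.of_bound hm (|g l| + (eVariationOn g (Icc l b)).toReal)
    (ae_restrict_of_forall_mem measurableSet_Icc fun y hy =>
      abs_le_abs_add_eVariationOn hg hy (left_mem_Icc.2 hlb))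

theorem abs_le_of_boundedVariationOn (hlb : l < b) (hg : BoundedVariationOn g (Icc l b))
    (hx : x ∈ Icc l b) : |g x| ≤ (1 + (b - l)⁻¹) * bvNorm g (Icc l b) := by
  set V := (eVariationOn g (Icc l b)).toReal
  have hV : 0 ≤ V := ENNReal.toReal_nonneg
  have hI : 0 ≤ ∫ y in Icc l b, |g y| := integral_nonneg fun _ => abs_nonneg _
  have hbl : 0 < b - l := sub_pos.2 hlb
  have hint : IntegrableOn (fun y => |g y|) (Icc l b) := (integrableOn_of_boundedVariationOn hg).abs
  have hmean : (b - l) * |g x| ≤ (∫ y in Icc l b, |g y|) + (b - l) * V := by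
    have h := setIntegral_mono_on (integrable_const (|g x|)) (hint.add (integrable_const V))
      measurableSet_Icc fun y hy => abs_le_abs_add_eVariationOn hg hx hy
    rw [integral_add' hint (integrable_const V)] at h
    simpa [hlb.le] using h
  calc |g x| = (b - l)⁻¹ * ((b - l) * |g x|) := by field_simp
    _ ≤ (b - l)⁻¹ * ((∫ y in Icc l b, |g y|) + (b - l) * V) := by gcongr
    _ = (b - l)⁻¹ * (∫ y in Icc l b, |g y|) + V := by field_simp
    _ ≤ (b - l)⁻¹ * (∫ y in Icc l b, |g y|) + V + ((b - l)⁻¹ * V + ∫ y in Icc l b, |g y|) :=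
      le_add_of_nonneg_right (add_nonneg (mul_nonneg (inv_nonneg.2 hbl.le) hV) hI)
    _ = (1 + (b - l)⁻¹) * bvNorm g (Icc l b) := by rw [bvNorm]; ring

theorem boundedVariationOn_of_lipschitzWith {M : NNReal} (hg : LipschitzWith M g) :
    BoundedVariationOn g (Icc l b) :=
  (hg.lipschitzOnWith (s := Icc l b)).comp_boundedVariationOn (mapsTo_id _)
    (BoundedVariationOn.id_Icc l b)

end BoundedVariation

/-! ### Trapping intervals -/

/-- The noisy chain does not leave the interval `[α, β]`, on which the noise does not degenerate
and which contains the attracting transitive interval `[d₁, d₂]` of the map. Map and amplitude are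
continuous on the whole real line, which a constant extension beyond the state space achieves. -/
structure IsTrapped (T s χ : ℝ → ℝ) (a α β d₁ d₂ : ℝ) : Prop where
  bump : IsBump χ a
  a_pos : 0 < a
  continuous_map : Continuous T
  continuous_amp : Continuous s
  amp_pos : ∀ x ∈ Icc α β, 0 < s x
  step_mem : ∀ x ∈ Icc α β, ∀ u ∈ Icc (-a) a, T x + s x * u ∈ Icc α β
  lt : d₁ < d₂
  subset : Icc d₁ d₂ ⊆ Icc α β
  forward_invariant : MapsTo T (Icc d₁ d₂) (Icc d₁ d₂)
  transitive : TransitiveOn T (Icc d₁ d₂)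
  absorbing : ∀ᵐ x ∂volume.restrict (Icc α β),
    ∀ U : Set ℝ, IsOpen U → Icc d₁ d₂ ⊆ U → ∃ k : ℕ, T^[k] x ∈ U

namespace IsTrapped

variable {T s χ : ℝ → ℝ} {a α β d₁ d₂ x v : ℝ} {V : Set ℝ} (h : IsTrapped T s χ a α β d₁ d₂)

include h

theorem bounds_lt : α < β :=
  (h.subset (left_mem_Icc.2 h.lt.le)).1.trans_lt
    (h.lt.trans_le (h.subset (right_mem_Icc.2 h.lt.le)).2)

theorem isMarkovKernel : IsMarkovKernel (transitionKernel T s χ) :=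
  isMarkovKernel_transitionKernel h.bump h.a_pos h.continuous_map.measurable
    h.continuous_amp.measurable

theorem apply (x : ℝ) : transitionKernel T s χ x = transition T s χ x :=
  transitionKernel_apply h.continuous_map.measurable h.continuous_amp.measurable x

theorem isFeller : IsFeller (transitionKernel T s χ) :=
  isFeller_transitionKernel h.continuous_map h.continuous_amp

theorem isAbsorbing : IsAbsorbing (transitionKernel T s χ) (Icc α β) := fun x hx => by
  rw [h.apply]
  exact ae_mem_transition h.bump measurableSet_Icc (h.step_mem x hx)

theorem mapsTo : MapsTo T (Icc α β) (Icc α β) := fun x hx => by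
  simpa using h.step_mem x hx 0 ⟨neg_nonpos.2 h.a_pos.le, h.a_pos.le⟩

theorem mem_accessible_of_dist_lt (hV : IsOpen V) (hx : x ∈ Icc α β) (hv : |v - T x| < a * s x)
    (hvV : v ∈ accessible (transitionKernel T s χ) V) :
    x ∈ accessible (transitionKernel T s χ) V := by
  refine accessible_accessible_subset hV.measurableSet ⟨1, ?_⟩
  rw [pow_one, h.apply]
  exact transition_ne_zero_of_dist_lt h.bump h.a_pos (h.isFeller.isOpen_accessible hV)
    (h.amp_pos x hx) hv hvV

theorem mem_accessible_of_iterate_mem (hV : IsOpen V) (hx : x ∈ Icc α β) {k : ℕ}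
    (hk : T^[k] x ∈ accessible (transitionKernel T s χ) V) :
    x ∈ accessible (transitionKernel T s χ) V := by
  induction k generalizing x with
  | zero => exact hk
  | succ k ih =>
    refine h.mem_accessible_of_dist_lt hV hx ?_ (ih (h.mapsTo hx) hk)
    simpa using mul_pos h.a_pos (h.amp_pos x hx)

/-- By transitivity, an orbit that starts within one noisy step of `w` enters `V`. -/
theorem Icc_subset_accessible (hV : IsOpen V) (hne : (V ∩ Icc d₁ d₂).Nonempty) :
    Icc d₁ d₂ ⊆ accessible (transitionKernel T s χ) V := by
  intro w hw
  have hrad : 0 < a * s w := mul_pos h.a_pos (h.amp_pos w (h.subset hw))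
  obtain ⟨t, v, hvV, hv, hvd⟩ := h.transitive V (Metric.ball (T w) (a * s w)) hV
    Metric.isOpen_ball hne ⟨T w, Metric.mem_ball_self hrad, h.forward_invariant hw⟩
  exact h.mem_accessible_of_dist_lt hV (h.subset hw) hv
    (h.mem_accessible_of_iterate_mem hV (h.subset hvd) (subset_accessible hV.measurableSet hvV))

/-- Within one noisy step of `x` there is a point with an orbit that approaches `[d₁, d₂]`. -/
theorem trap_subset_accessible (hV : IsOpen V) (hne : (V ∩ Icc d₁ d₂).Nonempty) :
    Icc α β ⊆ accessible (transitionKernel T s χ) V := by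
  intro x hx
  have hnear : (Metric.ball (T x) (a * s x) ∩ Ioo α β).Nonempty := by
    have hcl : T x ∈ closure (Ioo α β) := closure_Ioo h.bounds_lt.ne ▸ h.mapsTo hx
    exact mem_closure_iff.1 hcl _ Metric.isOpen_ball
      (Metric.mem_ball_self (mul_pos h.a_pos (h.amp_pos x hx)))
  have hpos := (Metric.isOpen_ball.inter isOpen_Ioo).measure_ne_zero volume hnear
  obtain ⟨v, ⟨hv, hvI⟩, hvabs⟩ := nonempty_of_not_subset fun hsub => hpos <|
    measure_mono_null hsub ((ae_restrict_iff' measurableSet_Icc).1 h.absorbing)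
  simp only [mem_compl_iff, mem_ofPred_eq, not_not] at hvabs
  have hvI' : v ∈ Icc α β := Ioo_subset_Icc_self hvI
  obtain ⟨k, hk⟩ := hvabs hvI' _ (h.isFeller.isOpen_accessible hV) (h.Icc_subset_accessible hV hne)
  exact h.mem_accessible_of_dist_lt hV hx hv (h.mem_accessible_of_iterate_mem hV hvI' hk)

/-- A neighbourhood `B` of a fixed point `z` of the map returns to itself in one step, and the
kernel density is bounded below near `z`. -/
theorem isSmallSet : IsSmallSet (transitionKernel T s χ) (Icc α β) := by
  obtain ⟨z, hz, hfix⟩ := exists_mem_Icc_isFixedPt_of_mapsTo h.continuous_map.continuousOn h.lt.le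
    h.forward_invariant
  have hsz : 0 < s z := h.amp_pos z (h.subset hz)
  obtain ⟨u, -, hu⟩ := h.bump.exists_mem_pos isOpen_univ (mem_univ 0)
    ⟨neg_nonpos.2 h.a_pos.le, h.a_pos.le⟩
  have hsnear : ∀ᶠ y in 𝓝 z, 0 < s y := h.continuous_amp.continuousAt.eventually_const_lt hsz
  have hzball : |z - T z| < a * s z := by simpa [hfix.eq] using mul_pos h.a_pos hsz
  have hball : ∀ᶠ y in 𝓝 z, |z - T y| < a * s y :=
    (continuous_const.sub h.continuous_map).abs.continuousAt.eventually_lt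
      (continuous_const.mul h.continuous_amp).continuousAt hzball
  obtain ⟨ν, hν, hle⟩ := exists_minorant_of_continuousAt (m := volume)
    (P := transitionKernel T s χ) (p := kernelDensity T s χ)
    (continuousAt_uncurry_kernelDensity h.bump h.continuous_map.continuousAt
      h.continuous_amp.continuousAt hsz.ne' (T z + s z * u))
    ((kernelDensity_pos_iff hsz).2 (h.bump.noiseDensity_pos h.a_pos hu))
    (hsnear.mono fun y hy => (h.apply y).trans (transition_eq_withDensity h.bump hy))
  obtain ⟨B, hB, hBo, hzB⟩ := eventually_nhds_iff.1 (hsnear.and (hball.and hle))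
  refine isSmallSet_of_subset_accessible h.isFeller isCompact_Icc hBo (fun y hy => ?_)
    (h.trap_subset_accessible hBo ⟨z, hzB, hz⟩) hν fun y hy => (hB y hy).2.2
  rw [h.apply]
  exact transition_ne_zero_of_dist_lt h.bump h.a_pos hBo (hB y hy).1 (hB y hy).2.1 hzB

theorem isUniformlyErgodicOn {μ : Measure ℝ} [IsProbabilityMeasure μ]
    (hμ : (transitionKernel T s χ).Invariant μ) (hμI : ∀ᵐ x ∂μ, x ∈ Icc α β) :
    IsUniformlyErgodicOn (transitionKernel T s χ) (Icc α β) μ :=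
  have := h.isMarkovKernel
  h.isSmallSet.isUniformlyErgodicOn measurableSet_Icc h.isAbsorbing hμ hμI

theorem exists_invariant : ∃ μ, IsProbabilityMeasure μ ∧ (∀ᵐ x ∂μ, x ∈ Icc α β) ∧
    (transitionKernel T s χ).Invariant μ :=
  have := h.isMarkovKernel
  h.isSmallSet.exists_invariant measurableSet_Icc (nonempty_Icc.2 h.bounds_lt.le) h.isAbsorbing

theorem exists_lipschitzWith_density {μ : Measure ℝ} [IsProbabilityMeasure μ]
    (hμ : (transitionKernel T s χ).Invariant μ) (hμI : ∀ᵐ x ∂μ, x ∈ Icc α β) :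
    ∃ (M : NNReal) (ρ : ℝ → ℝ), (∀ y, 0 ≤ ρ y) ∧ LipschitzWith M ρ ∧
      μ = volume.withDensity fun y => ENNReal.ofReal (ρ y) := by
  have := h.isMarkovKernel
  obtain ⟨x₀, hx₀, hmin⟩ := isCompact_Icc.exists_isMinOn (nonempty_Icc.2 h.bounds_lt.le)
    h.continuous_amp.continuousOn
  have hs₀ : 0 < s x₀ := h.amp_pos x₀ hx₀
  have hamp : ∀ᵐ x ∂μ, s x₀ ≤ s x := hμI.mono fun x hx => isMinOn_iff.1 hmin x hx
  have hmeas := measurable_uncurry_kernelDensity h.bump h.continuous_map.measurable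
    h.continuous_amp.measurable
  have hnn : ∀ᵐ x ∂μ, ∀ y, 0 ≤ kernelDensity T s χ x y :=
    hamp.mono fun x hx => kernelDensity_nonneg h.bump (hs₀.le.trans hx)
  have hp : HasTransitionDensity (transitionKernel T s χ) (kernelDensity T s χ) μ volume :=
    ⟨hmeas.aestronglyMeasurable, hnn, hamp.mono fun x hx =>
      (h.apply x).trans (transition_eq_withDensity h.bump (hs₀.trans_le hx))⟩
  obtain ⟨D, hD⟩ := exists_kernelDensity_le h.bump hs₀
  obtain ⟨M, hM⟩ := exists_lipschitzWith_kernelDensity h.bump hs₀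
  have hint (y : ℝ) : Integrable (fun x => kernelDensity T s χ x y) μ :=
    .of_bound (hmeas.comp measurable_prodMk_right).aestronglyMeasurable D
      (hamp.mono fun x hx => hD T s x hx y)
  refine ⟨M, fun y => ∫ x, kernelDensity T s χ x y ∂μ,
    fun y => integral_nonneg_of_ae (hnn.mono fun x hx => hx y),
    lipschitzWith_integral hint (hamp.mono fun x hx => hM T s x hx), ?_⟩
  simpa only [ofReal_integral_eq_lintegral_ofReal (hint _) (hnn.mono fun _ hx => hx _)] using
    hp.eq_withDensity_of_invariant hμ

theorem subset_support {μ : Measure ℝ} [IsProbabilityMeasure μ]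
    (hμ : (transitionKernel T s χ).Invariant μ) (hμI : ∀ᵐ x ∂μ, x ∈ Icc α β) :
    Icc d₁ d₂ ⊆ μ.support := by
  intro w hw
  rw [Measure.mem_support_iff_forall]
  intro V hV
  obtain ⟨U, hUV, hU, hwU⟩ := mem_nhds_iff.1 hV
  refine lt_of_lt_of_le (pos_iff_ne_zero.2 ?_) (measure_mono hUV)
  exact measure_ne_zero_of_accessible hμ hU.measurableSet
    (hμI.mono fun _ hx => h.trap_subset_accessible hU ⟨w, hwU, hw⟩ hx)

end IsTrapped

/-! ### The noisy system on `[-Γ, 1]` -/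

theorem TransitiveOn.surjOn {S : ℝ → ℝ} {l b : ℝ} (hS : TransitiveOn S (Icc l b)) (hlb : l < b)
    (hcont : ContinuousOn S (Icc l b)) (hmaps : MapsTo S (Icc l b) (Icc l b)) :
    SurjOn S (Icc l b) (Icc l b) := by
  have hclosed : IsClosed (S '' Icc l b) := (isCompact_Icc.image_of_continuousOn hcont).isClosed
  suffices hIoo : Ioo l b ⊆ S '' Icc l b from
    closure_Ioo hlb.ne ▸ hclosed.closure_subset_iff.2 hIoo
  intro p hp
  by_contra hpS
  -- An orbit from the right of `p` to the left of `p` near `p` ends in the image of `S`.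
  have hO : IsOpen ((S '' Icc l b)ᶜ ∩ Ioo l b) := hclosed.isOpen_compl.inter isOpen_Ioo
  have hnhds : (S '' Icc l b)ᶜ ∩ Ioo l b ∈ 𝓝 p := hO.mem_nhds ⟨hpS, hp⟩
  obtain ⟨x, hx, hxO⟩ := ((frequently_lt_nhds p).and_eventually hnhds).exists
  obtain ⟨y, hy, hyO⟩ := ((frequently_gt_nhds p).and_eventually hnhds).exists
  obtain ⟨t, v, ⟨hvU, hvl⟩, ⟨-, hvr⟩, hv⟩ := hS _ _ (hO.inter isOpen_Iio) (hO.inter isOpen_Ioi)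
    ⟨x, ⟨hxO, hx⟩, Ioo_subset_Icc_self hxO.2⟩ ⟨y, ⟨hyO, hy⟩, Ioo_subset_Icc_self hyO.2⟩
  cases t with
  | zero => exact lt_asymm (show v < p from hvl) (show p < v from hvr)
  | succ t =>
    rw [Function.iterate_succ_apply'] at hvU
    exact hvU.1 ⟨_, hmaps.iterate t hv, rfl⟩

/-- The interval `[-Γ/2, 1 - Γ/2]`, in which the chain stays from its first step on. -/
def core (T : ℝ → ℝ) (c : ℝ) : Set ℝ := Icc (-(gap T c / 2)) (1 - gap T c / 2)

/-- A map of the state space with an attracting transitive interval `[d₁, d₂]`, perturbed by noise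
of amplitude `s`: the conditions of `IsRandomSystem` on a single amplitude, without those that
concern invariant measures of the map, its iterates, or differentiability. -/
structure IsNoisySystem (T : ℝ → ℝ) (c d₁ d₂ : ℝ) (s χ : ℝ → ℝ) (a : ℝ) : Prop where
  mapsTo : MapsTo T (Icc 0 1) (Icc 0 1)
  max_mem : c ∈ Icc (0 : ℝ) 1
  le_max : ∀ x ∈ Icc (0 : ℝ) 1, T x ≤ T c
  max_lt_one : T c < 1
  continuousOn_map : ContinuousOn T (stateSpace T c)
  antitoneOn : AntitoneOn T (Icc (-(gap T c)) 0)
  left_le : T (-(gap T c)) ≤ T c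
  lt : d₁ < d₂
  subset : Icc d₁ d₂ ⊆ Icc (0 : ℝ) 1
  forward_invariant : MapsTo T (Icc d₁ d₂) (Icc d₁ d₂)
  transitive : TransitiveOn T (Icc d₁ d₂)
  absorbing : ∀ᵐ x ∂volume.restrict (Icc (0 : ℝ) 1),
    ∀ U : Set ℝ, IsOpen U → Icc d₁ d₂ ⊆ U → ∃ k : ℕ, T^[k] x ∈ U
  continuousOn_amp : ContinuousOn s (stateSpace T c)
  amp_nonneg : ∀ x ∈ stateSpace T c, 0 ≤ s x
  amp_pos : ∀ x ∈ stateSpace T c, x ≠ 0 → x ≠ 1 → 0 < s x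
  a_pos : 0 < a
  bump : IsBump χ a
  cases : (∃ ε, FixedOriginCase T c s a ε) ∨ PositiveInterceptCase T c s a

theorem IsRandomSystem.isNoisySystem {T : ℝ → ℝ} {c d₁ d₂ : ℝ} {σ : ℕ → ℝ → ℝ} {χ : ℝ → ℝ}
    {a : ℝ} {n : ℕ} (h : IsRandomSystem T c d₁ d₂ σ χ a n) :
    IsNoisySystem T c d₁ d₂ (σ n) χ a where
  mapsTo := h.map.mapsTo
  max_mem := h.map.max_mem
  le_max x hx := by
    rcases eq_or_ne x c with rfl | hxc
    exacts [le_rfl, (h.map.max_unique x hx hxc).le]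
  max_lt_one := h.map.max_lt_one
  continuousOn_map := h.map.continuousOn
  antitoneOn := h.map.antitoneOn
  left_le := h.map.left_lt.le
  lt := h.map.lt
  subset := h.map.subset
  forward_invariant := h.map.forward_invariant
  transitive := by simpa using h.map.transitive 1 le_rfl
  absorbing := h.map.absorbing
  continuousOn_amp := h.amplitude.continuousOn n h.index_pos
  amp_nonneg := h.amplitude.nonneg n h.index_pos
  amp_pos := h.amplitude.pos n h.index_pos
  a_pos := h.a_pos
  bump := h.bump
  cases := h.cases

namespace IsNoisySystem

variable {T s χ : ℝ → ℝ} {c d₁ d₂ a : ℝ} (h : IsNoisySystem T c d₁ d₂ s χ a) {x u m : ℝ}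

include h

theorem gap_pos : 0 < gap T c :=
  sub_pos.2 h.max_lt_one

theorem gap_le_one : gap T c ≤ 1 :=
  sub_le_self _ (h.mapsTo h.max_mem).1

theorem max_lt : T c < 1 - gap T c / 2 := by
  have := h.gap_pos
  rw [gap] at *
  linarith

theorem unitInterval_subset_stateSpace : Icc 0 1 ⊆ stateSpace T c :=
  Icc_subset_Icc_left (neg_nonpos.2 h.gap_pos.le)

theorem core_subset_stateSpace : core T c ⊆ stateSpace T c :=
  Icc_subset_Icc (by linarith [h.gap_pos]) (by linarith [h.gap_pos])

theorem map_zero_le (hx : x ∈ Icc (-(gap T c)) 0) : T 0 ≤ T x :=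
  h.antitoneOn hx ⟨neg_nonpos.2 h.gap_pos.le, le_rfl⟩ hx.2

theorem map_mem (hx : x ∈ stateSpace T c) : T x ∈ Icc 0 (T c) := by
  rcases le_total 0 x with h0 | h0
  · exact ⟨(h.mapsTo ⟨h0, hx.2⟩).1, h.le_max x ⟨h0, hx.2⟩⟩
  · have hx' : x ∈ Icc (-(gap T c)) 0 := ⟨hx.1, h0⟩
    exact ⟨(h.mapsTo ⟨le_rfl, zero_le_one⟩).1.trans (h.map_zero_le hx'),
      (h.antitoneOn ⟨le_rfl, hx.1.trans h0⟩ hx' hx.1).trans h.left_le⟩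

theorem surjOn : SurjOn T (Icc d₁ d₂) (Icc d₁ d₂) :=
  h.transitive.surjOn h.lt
    (h.continuousOn_map.mono (h.subset.trans h.unitInterval_subset_stateSpace)) h.forward_invariant

theorem right_lt : d₂ < 1 - gap T c / 2 := by
  obtain ⟨x, hx, hxd⟩ := h.surjOn (right_mem_Icc.2 h.lt.le)
  exact hxd ▸ (h.le_max x (h.subset hx)).trans_lt h.max_lt

theorem amp_le (hx : x ∈ stateSpace T c) : s x ≤ sigmaMax T c s :=
  le_csSup (isCompact_Icc.image_of_continuousOn h.continuousOn_amp).bddAbove ⟨x, hx, rfl⟩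

theorem sigmaMax_pos : 0 < sigmaMax T c s := by
  have hhalf : (1 / 2 : ℝ) ∈ stateSpace T c :=
    h.unitInterval_subset_stateSpace (by constructor <;> norm_num)
  exact (h.amp_pos _ hhalf (by norm_num) (by norm_num)).trans_le (h.amp_le hhalf)

theorem mul_amp_le (hm : a ≤ 1 / sigmaMax T c s * m) (hx : x ∈ stateSpace T c) :
    a * s x ≤ m := by
  rw [one_div, ← div_eq_inv_mul, le_div_iff₀ h.sigmaMax_pos] at hm
  exact (mul_le_mul_of_nonneg_left (h.amp_le hx) h.a_pos.le).trans hm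

theorem mul_amp_le_half_gap (hx : x ∈ stateSpace T c) : a * s x ≤ gap T c / 2 := by
  rcases h.cases with ⟨ε, hε⟩ | hpos
  · exact h.mul_amp_le hε.bound hx
  · exact h.mul_amp_le (hpos.bound.trans <| mul_le_mul_of_nonneg_left (min_le_left _ _)
      (one_div_nonneg.2 h.sigmaMax_pos.le)) hx

theorem lower_le (hx : x ∈ stateSpace T c) (hu : u ∈ Icc (-a) a) :
    T x - a * s x ≤ T x + s x * u := by
  linarith [mul_le_mul_of_nonneg_left hu.1 (h.amp_nonneg x hx)]

theorem step_mem_core (hx : x ∈ stateSpace T c) (hu : u ∈ Icc (-a) a) :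
    T x + s x * u ∈ core T c := by
  have hamp := h.mul_amp_le_half_gap hx
  have hmap := h.map_mem hx
  refine ⟨by linarith [h.lower_le hx hu, hmap.1], ?_⟩
  have hupper : s x * u ≤ a * s x := by
    linarith [mul_le_mul_of_nonneg_left hu.2 (h.amp_nonneg x hx)]
  have hgap : T c = 1 - gap T c := by rw [gap]; ring
  linarith [hmap.2]

theorem step_mem_of_le_lower {α : ℝ} (hx : x ∈ stateSpace T c) (hα : α ≤ T x - a * s x)
    (hu : u ∈ Icc (-a) a) : T x + s x * u ∈ Icc α (1 - gap T c / 2) :=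
  ⟨hα.trans (h.lower_le hx hu), (h.step_mem_core hx hu).2⟩

theorem continuousOn_lower : ContinuousOn (fun x => T x - a * s x) (stateSpace T c) :=
  h.continuousOn_map.sub (continuousOn_const.mul h.continuousOn_amp)

end IsNoisySystem

/-! ### The chain as a kernel on the line -/

namespace IsNoisySystem

variable {T s χ : ℝ → ℝ} {c d₁ d₂ a : ℝ} (h : IsNoisySystem T c d₁ d₂ s χ a)

/-- The extension of a function from the state space to the line that is constant on either side.
It makes map and amplitude continuous, so that the chain becomes a Feller kernel on `ℝ`. -/
noncomputable def extend (f : ℝ → ℝ) : ℝ → ℝ :=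
  IccExtend (neg_le.1 (neg_one_lt_zero.le.trans h.gap_pos.le)) fun x => f x

/-- The chain of the extended system. It agrees with `transition T s χ` on the state space only. -/
noncomputable def chain : Kernel ℝ ℝ :=
  transitionKernel (h.extend T) (h.extend s) χ

include h

theorem extend_eqOn (f : ℝ → ℝ) : EqOn (h.extend f) f (stateSpace T c) := fun _ hx =>
  IccExtend_of_mem _ _ hx

theorem continuous_extend {f : ℝ → ℝ} (hf : ContinuousOn f (stateSpace T c)) :
    Continuous (h.extend f) :=
  (continuousOn_iff_continuous_domRestrict.1 hf).Icc_extend'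

theorem isMarkovKernel_chain : IsMarkovKernel h.chain :=
  isMarkovKernel_transitionKernel h.bump h.a_pos
    (h.continuous_extend h.continuousOn_map).measurable
    (h.continuous_extend h.continuousOn_amp).measurable

theorem chain_apply {x : ℝ} (hx : x ∈ stateSpace T c) : h.chain x = transition T s χ x := by
  rw [chain, transitionKernel_apply (h.continuous_extend h.continuousOn_map).measurable
    (h.continuous_extend h.continuousOn_amp).measurable]
  simp only [transition, h.extend_eqOn _ hx]

theorem ae_mem_chain {x : ℝ} {K : Set ℝ} (hx : x ∈ stateSpace T c) (hK : MeasurableSet K)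
    (hstep : ∀ u ∈ Icc (-a) a, T x + s x * u ∈ K) : ∀ᵐ y ∂h.chain x, y ∈ K := by
  rw [h.chain_apply hx]
  exact ae_mem_transition h.bump hK hstep

theorem ae_mem_core_chain {x : ℝ} (hx : x ∈ stateSpace T c) : ∀ᵐ y ∂h.chain x, y ∈ core T c :=
  h.ae_mem_chain hx measurableSet_Icc fun _ => h.step_mem_core hx

theorem isAbsorbing_stateSpace : IsAbsorbing h.chain (stateSpace T c) := fun _ hx =>
  (h.ae_mem_core_chain hx).mono fun _ hy => h.core_subset_stateSpace hy

theorem isStationary_iff {ν : Measure ℝ} : IsStationary T c s χ ν ↔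
    IsProbabilityMeasure ν ∧ (∀ᵐ x ∂ν, x ∈ stateSpace T c) ∧ h.chain.Invariant ν := by
  have hbind (hν : ∀ᵐ x ∂ν, x ∈ stateSpace T c) {A : Set ℝ} (hA : MeasurableSet A) :
      ν.bind h.chain A = ∫⁻ x, transition T s χ x A ∂ν := by
    rw [Measure.bind_apply hA h.chain.measurable.aemeasurable]
    exact lintegral_congr_ae (hν.mono fun x hx => by simp only [h.chain_apply hx])
  constructor
  · rintro ⟨hprob, hconc, hstat⟩
    exact ⟨hprob, hconc, Measure.ext fun A hA => (hbind hconc hA).trans (hstat A hA)⟩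
  · rintro ⟨hprob, hconc, hinv⟩
    exact ⟨hprob, hconc, fun A hA => by rw [← hbind hconc hA, hinv.def]⟩

theorem ae_mem_core {ν : Measure ℝ} (hν : IsStationary T c s χ ν) : ∀ᵐ x ∂ν, x ∈ core T c := by
  obtain ⟨-, hconc, hinv⟩ := h.isStationary_iff.1 hν
  exact ae_of_invariant_of_ae_ae hinv measurableSet_Icc (hconc.mono fun x => h.ae_mem_core_chain)

theorem hasTransitionDensity_chain : HasTransitionDensity h.chain (kernelDensity T s χ)
    (volume.restrict (stateSpace T c)) (volume.restrict (stateSpace T c)) := by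
  have hmem : ∀ᵐ x ∂volume.restrict (stateSpace T c), x ∈ stateSpace T c :=
    ae_restrict_mem measurableSet_Icc
  have hne (z : ℝ) : ∀ᵐ x ∂volume.restrict (stateSpace T c), x ≠ z :=
    ae_restrict_of_ae (Measure.ae_ne volume z)
  refine ⟨?_, hmem.mono fun x hx => kernelDensity_nonneg h.bump (h.amp_nonneg x hx), ?_⟩
  · have hmeas : Measurable
        (Function.uncurry (kernelDensity (h.extend T) (h.extend s) χ)) :=
      measurable_uncurry_kernelDensity h.bump (h.continuous_extend h.continuousOn_map).measurable
        (h.continuous_extend h.continuousOn_amp).measurable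
    refine hmeas.aestronglyMeasurable.congr ?_
    filter_upwards [Measure.quasiMeasurePreserving_fst.ae hmem] with z hz
    simp only [Function.uncurry, kernelDensity, h.extend_eqOn _ hz]
  · filter_upwards [hmem, hne 0, hne 1] with x hx hx0 hx1
    calc h.chain x = (h.chain x).restrict (stateSpace T c) :=
          (Measure.restrict_eq_self_of_ae_mem (h.isAbsorbing_stateSpace x hx)).symm
      _ = _ := by
        rw [h.chain_apply hx, transition_eq_withDensity h.bump (h.amp_pos x hx hx0 hx1),
          restrict_withDensity (s := stateSpace T c) measurableSet_Icc]

end IsNoisySystem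

/-! ### Barriers -/

/-- A level `α` below which the chain never falls once it is in `[α, 1 - Γ/2]`. -/
structure IsBarrier (T : ℝ → ℝ) (c d₁ : ℝ) (s : ℝ → ℝ) (a α : ℝ) : Prop where
  pos : 0 < α
  le_left : α ≤ d₁
  le_lower : ∀ x ∈ Icc α (1 - gap T c / 2), α ≤ T x - a * s x

namespace IsNoisySystem

variable {T s χ : ℝ → ℝ} {c d₁ d₂ a α ε x : ℝ} {μ ν : Measure ℝ}
  (h : IsNoisySystem T c d₁ d₂ s χ a)

include h

theorem Icc_subset_core (hα : 0 ≤ α) : Icc α (1 - gap T c / 2) ⊆ core T c :=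
  Icc_subset_Icc_left (by linarith [h.gap_pos])

theorem iterate_extend_eqOn {K : Set ℝ} (hK : K ⊆ stateSpace T c) (hmaps : MapsTo T K K) (t : ℕ) :
    EqOn ((h.extend T)^[t]) T^[t] K := by
  induction t with
  | zero => exact fun _ _ => rfl
  | succ t ih =>
    intro x hx
    rw [Function.iterate_succ_apply, Function.iterate_succ_apply, h.extend_eqOn T (hK hx)]
    exact ih (hmaps hx)

theorem isTrapped (hα : IsBarrier T c d₁ s a α) :
    IsTrapped (h.extend T) (h.extend s) χ a α (1 - gap T c / 2) d₁ d₂ := by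
  have hsub : Icc α (1 - gap T c / 2) ⊆ stateSpace T c :=
    (h.Icc_subset_core hα.pos.le).trans h.core_subset_stateSpace
  have hd : Icc d₁ d₂ ⊆ Icc α (1 - gap T c / 2) := Icc_subset_Icc hα.le_left h.right_lt.le
  have hunit : Icc α (1 - gap T c / 2) ⊆ Icc 0 1 :=
    Icc_subset_Icc hα.pos.le (by linarith [h.gap_pos])
  refine ⟨h.bump, h.a_pos, h.continuous_extend h.continuousOn_map,
    h.continuous_extend h.continuousOn_amp, fun x hx => ?_, fun x hx u hu => ?_,
    h.lt, hd, fun x hx => ?_, fun U V hU hV hUd hVd => ?_, ?_⟩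
  · rw [h.extend_eqOn s (hsub hx)]
    exact h.amp_pos x (hsub hx) (hα.pos.trans_le hx.1).ne' (by linarith [hx.2, h.gap_pos])
  · rw [h.extend_eqOn T (hsub hx), h.extend_eqOn s (hsub hx)]
    exact h.step_mem_of_le_lower (hsub hx) (hα.le_lower x hx) hu
  · rw [h.extend_eqOn T (hsub (hd hx))]
    exact h.forward_invariant hx
  · obtain ⟨t, v, hvU, hv⟩ := h.transitive U V hU hV hUd hVd
    refine ⟨t, v, ?_, hv⟩
    rwa [mem_preimage, h.iterate_extend_eqOn (hd.trans hsub) h.forward_invariant t hv.2]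
  · filter_upwards [ae_restrict_of_ae_restrict_of_subset hunit h.absorbing,
      ae_restrict_mem measurableSet_Icc] with x hx hxI U hU hdU
    obtain ⟨k, hk⟩ := hx U hU hdU
    have hiter := h.iterate_extend_eqOn h.unitInterval_subset_stateSpace h.mapsTo k (hunit hxI)
    exact ⟨k, by rwa [hiter]⟩

theorem exists_isStationary (hα : IsBarrier T c d₁ s a α) : ∃ (μ : Measure ℝ) (ρ : ℝ → ℝ),
    IsStationary T c s χ μ ∧ (∀ᵐ x ∂μ, x ∈ Icc α (1 - gap T c / 2)) ∧ (∀ x, 0 ≤ ρ x) ∧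
      BoundedVariationOn ρ (stateSpace T c) ∧
      μ = (volume.restrict (stateSpace T c)).withDensity (fun x => ENNReal.ofReal (ρ x)) ∧
      Icc d₁ d₂ ⊆ μ.support := by
  have htrap := h.isTrapped hα
  obtain ⟨μ, hprob, hμα, hinv⟩ := htrap.exists_invariant
  obtain ⟨M, ρ, hρ, hlip, hdens⟩ := htrap.exists_lipschitzWith_density hinv hμα
  have hmem : ∀ᵐ x ∂μ, x ∈ stateSpace T c :=
    hμα.mono fun x hx => h.core_subset_stateSpace (h.Icc_subset_core hα.pos.le hx)
  refine ⟨μ, ρ, h.isStationary_iff.2 ⟨hprob, hmem, hinv⟩, hμα, hρ,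
    boundedVariationOn_of_lipschitzWith hlip, ?_, htrap.subset_support hinv hμα⟩
  conv_lhs => rw [← Measure.restrict_eq_self_of_ae_mem hmem, hdens]
  exact restrict_withDensity (s := stateSpace T c) measurableSet_Icc _

theorem isUniformlyErgodicOn (hα : IsBarrier T c d₁ s a α) (hμ : IsStationary T c s χ μ)
    (hμα : ∀ᵐ x ∂μ, x ∈ Icc α (1 - gap T c / 2)) :
    IsUniformlyErgodicOn h.chain (Icc α (1 - gap T c / 2)) μ :=
  have := hμ.prob
  (h.isTrapped hα).isUniformlyErgodicOn (h.isStationary_iff.1 hμ).2.2 hμα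

theorem isStationary_unique (hα : IsBarrier T c d₁ s a α) (hμ : IsStationary T c s χ μ)
    (hμα : ∀ᵐ x ∂μ, x ∈ Icc α (1 - gap T c / 2)) (hν : IsStationary T c s χ ν)
    (hνα : ∀ᵐ x ∂ν, x ∈ Icc α (1 - gap T c / 2)) : ν = μ := by
  have := hμ.prob
  have := hν.prob
  have := h.isMarkovKernel_chain
  exact (h.isUniformlyErgodicOn hα hμ hμα).eq_of_invariant (h.isStationary_iff.1 hν).2.2 hνα

theorem exponentialDecayOn {l b : ℝ} (hμ : IsUniformlyErgodicOn h.chain (Icc l b) μ) (hlb : l < b)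
    (hsub : Icc l b ⊆ stateSpace T c) : ExponentialDecayOn T c s χ μ (Icc l b) := by
  have := h.isMarkovKernel_chain
  have hdens := h.hasTransitionDensity_chain
  obtain ⟨r, C, hr, hr1, hC, hdecay⟩ := hdens.exists_abs_integral_iterate_transferOp_sub_le hμ
  have hlen : 0 < (b - l)⁻¹ := inv_pos.2 (sub_pos.2 hlb)
  refine ⟨r, C * (1 + (b - l)⁻¹), hr, hr1, mul_pos hC (add_pos one_pos hlen),
    fun f g hf hfJ hg t => ?_⟩
  have hf0 (x : ℝ) (hx : x ∉ Icc l b) : f x = 0 := Function.notMem_support.1 fun hx' => hx (hfJ hx')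
  have hφ := measurable_indicator_of_boundedVariationOn hg
  have hnorm : 0 ≤ bvNorm g (Icc l b) :=
    add_nonneg ENNReal.toReal_nonneg (integral_nonneg fun _ => abs_nonneg _)
  have hbound (x : ℝ) : |(Icc l b).indicator g x| ≤ (1 + (b - l)⁻¹) * bvNorm g (Icc l b) := by
    by_cases hx : x ∈ Icc l b
    · simpa only [indicator_of_mem hx] using abs_le_of_boundedVariationOn hlb hg hx
    · simp only [indicator_of_notMem hx, abs_zero]
      positivity
  have hrestrict {F : ℝ → ℝ} (hF : ∀ x ∉ Icc l b, F x = 0) :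
      ∫ x in stateSpace T c, F x = ∫ x, F x :=
    setIntegral_eq_integral_of_forall_compl_eq_zero fun x hx => hF x fun hx' => hx (hsub hx')
  have hproduct (F : ℝ → ℝ) :
      ∫ x in stateSpace T c, F x * (Icc l b).indicator g x = ∫ x in Icc l b, F x * g x := by
    simp only [← indicator_mul_right]
    rw [setIntegral_indicator measurableSet_Icc, inter_eq_self_of_subset_right hsub]
  refine ⟨?_, ?_⟩
  · exact ((hdens.integrable_iterate_transferOp hf.restrict t).mono_measure
      (Measure.restrict_mono_set volume hsub)).mul_bdd
      (integrableOn_of_boundedVariationOn hg).aestronglyMeasurable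
      (ae_restrict_of_forall_mem measurableSet_Icc fun x => abs_le_of_boundedVariationOn hlb hg)
  · have hdec := hdecay f _ hf.restrict hf0 hφ _ hbound t
    rw [hproduct, hrestrict hf0, hrestrict fun x hx => by simp [hf0 x hx],
      integral_indicator measurableSet_Icc] at hdec
    exact hdec.trans_eq (by ring)

/-! ### The case of a fixed point at the origin -/

section FixedOrigin

variable (hε : FixedOriginCase T c s a ε)

include hε

theorem eps_le_lower (hx : x ∈ Icc ε (1 - gap T c / 2)) : ε ≤ T x - a * s x := by
  have hsub : Icc ε (1 - gap T c / 2) ⊆ stateSpace T c :=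
    (h.Icc_subset_core hε.eps_pos.le).trans h.core_subset_stateSpace
  have hcl : x ∈ closure (Ioo ε (1 - gap T c / 2)) := by rwa [closure_Ioo hε.eps_lt.ne]
  exact ContinuousWithinAt.closure_le hcl continuousWithinAt_const
    ((h.continuousOn_lower x (hsub hx)).mono (Ioo_subset_Icc_self.trans hsub))
    fun y hy => (hε.lower_gt_eps y hy).le

/-- Otherwise orbits in `[d₁, d₂]` could not cross a point below `ε` from right to left. -/
theorem eps_le_left : ε ≤ d₁ := by
  by_contra! hlt
  obtain ⟨p, hp₁, hp₂⟩ := exists_between (lt_min hlt h.lt)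
  have hstep : MapsTo T (Icc d₁ d₂ ∩ Ioi p) (Icc d₁ d₂ ∩ Ioi p) := by
    rintro y ⟨hy, hpy⟩
    refine ⟨h.forward_invariant hy, mem_Ioi.2 ?_⟩
    have hamp : 0 ≤ a * s y :=
      mul_nonneg h.a_pos.le (h.amp_nonneg y (h.unitInterval_subset_stateSpace (h.subset hy)))
    have hd₁ : 0 ≤ d₁ := (h.subset (left_mem_Icc.2 h.lt.le)).1
    rcases lt_or_ge y ε with hyε | hyε
    · linarith [hε.lower_gt_self y ⟨hd₁.trans_lt (hp₁.trans hpy), hyε⟩, mem_Ioi.1 hpy]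
    · linarith [h.eps_le_lower hε ⟨hyε, hy.2.trans h.right_lt.le⟩,
        hp₂.trans_le (min_le_left _ _)]
  obtain ⟨t, v, hvU, hvV, hv⟩ := h.transitive (Iio p) (Ioi p) isOpen_Iio isOpen_Ioi
    ⟨d₁, hp₁, left_mem_Icc.2 h.lt.le⟩
    ⟨d₂, hp₂.trans_le (min_le_right _ _), right_mem_Icc.2 h.lt.le⟩
  exact lt_asymm (show T^[t] v < p from hvU) (hstep.iterate t ⟨hv, hvV⟩).2

theorem isBarrier_eps : IsBarrier T c d₁ s a ε :=
  ⟨hε.eps_pos, h.eps_le_left hε, fun _ => h.eps_le_lower hε⟩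

theorem ae_pos_of_fixedOrigin (hν : IsStationary T c s χ ν) (hν0 : ν {0} = 0) :
    ∀ᵐ x ∂ν, 0 < x := by
  have := hν.prob
  have := h.isMarkovKernel_chain
  have hinv := (h.isStationary_iff.1 hν).2.2
  have hcore := h.ae_mem_core hν
  have habs : IsAbsorbing h.chain (Ioc 0 (1 - gap T c / 2)) := fun x hx => by
    have hxS := h.core_subset_stateSpace (h.Icc_subset_core le_rfl (Ioc_subset_Icc_self hx))
    exact h.ae_mem_chain hxS measurableSet_Ioc fun u hu =>
      ⟨(hε.lower_pos x hx).trans_le (h.lower_le hxS hu), (h.step_mem_core hxS hu).2⟩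
  have henter : ∀ᵐ x ∂ν, x ∉ Ioc 0 (1 - gap T c / 2) →
      h.chain x (Ioc 0 (1 - gap T c / 2)) ≠ 0 := by
    filter_upwards [hcore, measure_eq_zero_iff_ae_notMem.1 hν0] with x hx hx0 hxn hzero
    have hxS := h.core_subset_stateSpace hx
    have hneg : x < 0 := lt_of_le_of_ne (not_lt.1 fun hpos => hxn ⟨hpos, hx.2⟩) hx0
    have hamp : 0 < s x := h.amp_pos x hxS hneg.ne (hneg.trans one_pos).ne
    have hpos : h.chain x (Ioi 0) ≠ 0 := by
      rw [h.chain_apply hxS]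
      exact transition_ne_zero h.bump h.a_pos isOpen_Ioi (right_mem_Icc.2 (by linarith [h.a_pos]))
        (add_pos_of_nonneg_of_pos (h.map_mem hxS).1 (mul_pos hamp h.a_pos))
    refine hpos (measure_eq_zero_iff_ae_notMem.2 ?_)
    filter_upwards [measure_eq_zero_iff_ae_notMem.1 hzero, h.ae_mem_core_chain hxS]
      with y hy hyc hy0
    exact hy ⟨hy0, hyc.2⟩
  exact (habs.ae_mem_of_invariant hinv measurableSet_Ioc henter).mono fun x hx => hx.1

theorem min_lower_le_integral_chain (hx : x ∈ Ioc 0 (1 - gap T c / 2)) :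
    min (T x - a * s x) ε ≤ ∫ y, min y ε ∂h.chain x := by
  have := h.isMarkovKernel_chain
  have hxS := h.core_subset_stateSpace (h.Icc_subset_core le_rfl (Ioc_subset_Icc_self hx))
  have hstep : ∀ᵐ y ∂h.chain x, T x - a * s x ≤ y :=
    h.ae_mem_chain hxS measurableSet_Ici fun u => h.lower_le hxS
  have hint : Integrable (fun y => min y ε) (h.chain x) :=
    .of_bound (by fun_prop) ε (hstep.mono fun y hy => by
      rw [Real.norm_of_nonneg (le_min ((hε.lower_pos x hx).le.trans hy) hε.eps_pos.le)]
      exact min_le_right y ε)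
  calc min (T x - a * s x) ε = ∫ _, min (T x - a * s x) ε ∂h.chain x := by simp
    _ ≤ _ := integral_mono_ae (integrable_const _) hint
      (hstep.mono fun y hy => min_le_min_right ε hy)

/-- `min x ε` is a Lyapunov function, which strictly increases in the mean on `(0, ε)`. -/
theorem ae_mem_of_fixedOrigin (hν : IsStationary T c s χ ν) (hν0 : ν {0} = 0) :
    ∀ᵐ x ∂ν, x ∈ Icc ε (1 - gap T c / 2) := by
  have := hν.prob
  have hpos : ∀ᵐ x ∂ν, x ∈ Ioc 0 (1 - gap T c / 2) := by
    filter_upwards [h.ae_mem_core hν, h.ae_pos_of_fixedOrigin hε hν hν0] with x hx hx0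
    exact ⟨hx0, hx.2⟩
  have hint : Integrable (fun x => min x ε) ν :=
    .of_bound (by fun_prop) ε (hpos.mono fun x hx => by
      rw [Real.norm_of_nonneg (le_min hx.1.le hε.eps_pos.le)]
      exact min_le_right x ε)
  have hlt {x : ℝ} (hx : x ∈ Ioc 0 (1 - gap T c / 2)) (hxε : x < ε) :
      min x ε < ∫ y, min y ε ∂h.chain x := by
    refine lt_of_lt_of_le ?_ (h.min_lower_le_integral_chain hε hx)
    rw [min_eq_left hxε.le]
    exact lt_min (hε.lower_gt_self x ⟨hx.1, hxε⟩) hxε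
  have hle : ∀ᵐ x ∂ν, min x ε ≤ ∫ y, min y ε ∂h.chain x := by
    filter_upwards [hpos] with x hx
    rcases lt_or_ge x ε with hxε | hxε
    · exact (hlt hx hxε).le
    · exact (min_le_right x ε).trans <| (le_min (h.eps_le_lower hε ⟨hxε, hx.2⟩) le_rfl).trans
        (h.min_lower_le_integral_chain hε hx)
  filter_upwards [hpos,
    ae_eq_integral_of_invariant (h.isStationary_iff.1 hν).2.2 hint hle] with x hx heq
  exact ⟨not_lt.1 fun hxε => (hlt hx hxε).ne heq, hx.2⟩

end FixedOrigin

/-! ### The case of a positive intercept -/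

theorem lower_pos_of_mem_core (hpos : PositiveInterceptCase T c s a) (hx : x ∈ core T c) :
    0 < T x - a * s x := by
  rcases lt_or_ge 0 x with hx0 | hx0
  · exact hpos.lower_pos x ⟨hx0, hx.2⟩
  · have hxS := h.core_subset_stateSpace hx
    have hbound : a * s x ≤ T 0 / 2 := h.mul_amp_le (hpos.bound.trans <|
      mul_le_mul_of_nonneg_left ((min_le_right _ _).trans (min_le_left _ _))
        (one_div_nonneg.2 h.sigmaMax_pos.le)) hxS
    linarith [hpos.map_zero_pos, h.map_zero_le ⟨hxS.1, hx0⟩]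

theorem exists_isBarrier (hpos : PositiveInterceptCase T c s a) :
    ∃ α, IsBarrier T c d₁ s a α ∧ ∀ x ∈ core T c, α ≤ T x - a * s x := by
  have hne : (core T c).Nonempty := nonempty_Icc.2 (by linarith [h.gap_pos, h.gap_le_one])
  obtain ⟨x₀, hx₀, hmin⟩ := IsCompact.exists_isMinOn (s := core T c) isCompact_Icc hne
    (h.continuousOn_lower.mono h.core_subset_stateSpace)
  have hlower := isMinOn_iff.1 hmin
  have hα := h.lower_pos_of_mem_core hpos hx₀
  refine ⟨_, ⟨hα, ?_, fun x hx => hlower x (h.Icc_subset_core hα.le hx)⟩, hlower⟩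
  obtain ⟨x, hx, hxd⟩ := h.surjOn (left_mem_Icc.2 h.lt.le)
  have hxcore : x ∈ core T c :=
    h.Icc_subset_core le_rfl ⟨(h.subset hx).1, hx.2.trans h.right_lt.le⟩
  have hamp : 0 ≤ a * s x :=
    mul_nonneg h.a_pos.le (h.amp_nonneg x (h.core_subset_stateSpace hxcore))
  linarith [hlower x hxcore]

theorem ae_mem_chain_of_mem_core (hα : ∀ x ∈ core T c, α ≤ T x - a * s x) (hx : x ∈ core T c) :
    ∀ᵐ y ∂h.chain x, y ∈ Icc α (1 - gap T c / 2) :=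
  h.ae_mem_chain (h.core_subset_stateSpace hx) measurableSet_Icc fun _ =>
    h.step_mem_of_le_lower (h.core_subset_stateSpace hx) (hα x hx)

theorem ae_mem_of_le_lower (hα : ∀ x ∈ core T c, α ≤ T x - a * s x)
    (hν : IsStationary T c s χ ν) : ∀ᵐ x ∂ν, x ∈ Icc α (1 - gap T c / 2) :=
  ae_of_invariant_of_ae_ae (h.isStationary_iff.1 hν).2.2 measurableSet_Icc
    ((h.ae_mem_core hν).mono fun _ => h.ae_mem_chain_of_mem_core hα)

theorem isUniformlyErgodicOn_stateSpace (hα : IsBarrier T c d₁ s a α)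
    (hlower : ∀ x ∈ core T c, α ≤ T x - a * s x) (hμ : IsStationary T c s χ μ) :
    IsUniformlyErgodicOn h.chain (stateSpace T c) μ := by
  have := hμ.prob
  have := h.isMarkovKernel_chain
  obtain ⟨-, hμS, hinv⟩ := h.isStationary_iff.1 hμ
  have henters : ∀ x ∈ stateSpace T c, ∀ᵐ y ∂(h.chain ^ 2) x, y ∈ Icc α (1 - gap T c / 2) :=
    fun x hx => by
      rw [pow_two]
      exact (Measure.ae_comp_iff measurableSet_Icc).2
        ((h.ae_mem_core_chain hx).mono fun _ => h.ae_mem_chain_of_mem_core hlower)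
  have hsmall : IsSmallSet h.chain (Icc α (1 - gap T c / 2)) := (h.isTrapped hα).isSmallSet
  exact (hsmall.of_enters 2 henters).isUniformlyErgodicOn measurableSet_Icc
    h.isAbsorbing_stateSpace hinv hμS

theorem exists_isBarrier_ae_mem : ∃ α, IsBarrier T c d₁ s a α ∧ ∀ ν : Measure ℝ,
    IsStationary T c s χ ν → (T 0 = 0 → ν {0} = 0) →
      ∀ᵐ x ∂ν, x ∈ Icc α (1 - gap T c / 2) := by
  rcases h.cases with ⟨ε, hε⟩ | hpos
  · exact ⟨ε, h.isBarrier_eps hε, fun ν hν hν0 =>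
      h.ae_mem_of_fixedOrigin hε hν (hν0 hε.map_zero)⟩
  · obtain ⟨α, hα, hlower⟩ := h.exists_isBarrier hpos
    exact ⟨α, hα, fun ν hν _ => h.ae_mem_of_le_lower hlower hν⟩

end IsNoisySystem

end HeteroChain

open HeteroChain in
theorem mainTheorem1_general {T s χ : ℝ → ℝ} {c d₁ d₂ a : ℝ}
    (h : IsNoisySystem T c d₁ d₂ s χ a) :
    ∃ (μ : Measure ℝ) (ρ : ℝ → ℝ),
      IsStationary T c s χ μ ∧
      (∀ ν : Measure ℝ, IsStationary T c s χ ν → (T 0 = 0 → ν {0} = 0) → ν = μ) ∧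
      (∀ x, 0 ≤ ρ x) ∧
      BoundedVariationOn ρ (stateSpace T c) ∧
      μ = (volume.restrict (stateSpace T c)).withDensity (fun x => ENNReal.ofReal (ρ x)) ∧
      Icc d₁ d₂ ⊆ μ.support ∧
      (∀ ε, FixedOriginCase T c s a ε →
        ExponentialDecayOn T c s χ μ (Icc ε (1 - gap T c / 2))) ∧
      (PositiveInterceptCase T c s a → ExponentialDecayOn T c s χ μ (stateSpace T c)) := by
  obtain ⟨α, hα, htrap⟩ := h.exists_isBarrier_ae_mem
  obtain ⟨μ, ρ, hμ, hμα, hρ, hbv, hdens, hsupp⟩ := h.exists_isStationary hα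
  have hμ0 : μ {0} = 0 := by
    refine hdens ▸ withDensity_absolutelyContinuous _ _ ?_
    exact Measure.restrict_le_self.absolutelyContinuous (measure_singleton 0)
  refine ⟨μ, ρ, hμ, fun ν hν hν0 => h.isStationary_unique hα hμ hμα hν (htrap ν hν hν0), hρ, hbv,
    hdens, hsupp, fun ε hε => ?_, fun hpos => ?_⟩
  · exact h.exponentialDecayOn
      (h.isUniformlyErgodicOn (h.isBarrier_eps hε) hμ (h.ae_mem_of_fixedOrigin hε hμ hμ0))
      hε.eps_lt ((h.Icc_subset_core hε.eps_pos.le).trans h.core_subset_stateSpace)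
  · obtain ⟨α, hα, hlower⟩ := h.exists_isBarrier hpos
    exact h.exponentialDecayOn (h.isUniformlyErgodicOn_stateSpace hα hlower hμ)
      (by linarith [h.gap_pos]) subset_rfl

open HeteroChain in
theorem mainTheorem1 (T : ℝ → ℝ) (c d₁ d₂ : ℝ) (σ : ℕ → ℝ → ℝ) (χ : ℝ → ℝ) (a : ℝ) (n : ℕ)
    (hS : IsRandomSystem T c d₁ d₂ σ χ a n) :
    ∃ (μ : Measure ℝ) (h : ℝ → ℝ),
      IsStationary T c (σ n) χ μ ∧
      (∀ ν : Measure ℝ, IsStationary T c (σ n) χ ν → (T 0 = 0 → ν {0} = 0) → ν = μ) ∧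
      (∀ x, 0 ≤ h x) ∧
      BoundedVariationOn h (stateSpace T c) ∧
      μ = (volume.restrict (stateSpace T c)).withDensity (fun x => ENNReal.ofReal (h x)) ∧
      Icc d₁ d₂ ⊆ μ.support ∧
      (∀ ε, FixedOriginCase T c (σ n) a ε →
        ExponentialDecayOn T c (σ n) χ μ (Icc ε (1 - gap T c / 2))) ∧
      (PositiveInterceptCase T c (σ n) a →
        ExponentialDecayOn T c (σ n) χ μ (stateSpace T c)) :=
  mainTheorem1_general hS.isNoisySystem
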